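/- **Conventions.** Fix $n\ge 0$ and $m\in\mathbb R$, and write $\langle\xi\rangle=(1+|\xi|^2)^{1/2}$. A symbol $a\in S^m(\mathbb R^k;\mathbb R^n)$ is a function $a\in C^\infty(\mathbb R^k\times\mathbb R^n)$ such that for every compact $C\subset\mathbb R^k$ and all multi-indices $\alpha,\beta$ there is a constant $A$ with $|D_x^\alpha D_\xi^\beta a(x,\xi)|\le A\langle\xi\rangle^{m-|\beta|}$ for all $x\in C$, $\xi\in\mathbb R^n$. For $a\in S^m(\mathbb R^n\times\mathbb R^n;\mathbb R^n)$ the oscillatory integral $\int e^{i\langle x-y,\xi\rangle}a(x,y,\xi)\,d\xi$ is the distribution on $\mathbb R^n\times\mathbb R^n$ $$\psi\mapsto\lim_{\varepsilon\to0^+}\iiint e^{i\langle x-y,\xi\rangle}\chi(\varepsilon\xi)\,a(x,y,\xi)\,\psi(x,y)\,dx\,dy\,d\xi,$$ where $\chi\in C_c^\infty(\mathbb R^n)$ equals $1$ near $0$ (the limit does not depend on $\chi$). A symbol $a(x,\xi)\in S^m(\mathbb R^n;\mathbb R^n)$ is *classical of order $m$* if there are functions $a_{m-j}(x,\xi)$,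 $j=0,1,2,\dots$, smooth for $\xi\ne0$ and positively homogeneous of degree $m-j$ in $\xi$, and a function $\phi\in C_c^\infty(\mathbb R^n)$ equal to $1$ near $0$, such that $a-\sum_{j<N}(1-\phi(\xi))\,a_{m-j}\in S^{m-N}$ for all $N\ge 0$. A linear operator $P$ on $C_c^\infty(\mathbb R^n)$ with Schwartz kernel $K\in\mathcal D'(\mathbb R^n\times\mathbb R^n)$, i.e. $\langle Pu,\varphi\rangle=\langle K(x,y),\varphi(x)u(y)\rangle$, is a *classical pseudo-differential operator of order $m$*, $P\in\Psi DO^m_{cl}(\mathbb R^n)$, if $K=\int e^{i\langle x-y,\xi\rangle}a(x,y,\xi)\,d\xi$ for some $a\in S^m(\mathbb R^n\times\mathbb R^n;\mathbb R^n)$ and, up to adding a kernel in $C^\infty(\mathbb R^n\times\mathbb R^n)$, $K$ is also equal to $\int e^{i\langle x-y,\xi\rangle}c(x,\xi)\,d\xi$ or to $\int e^{i\langle x-y,\xi\rangle}d(y,\xi)\,d\xi$ with a classical symbol $c$ or $d$ of order $m$. It is *properly supported* if both projections $\operatorname{supp}K\to\mathbb R^n$ are proper maps. For a compactly supported distribution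 $u$, the distribution $Pu$ is defined by $\langle Pu,\varphi\rangle=\langle u,P^t\varphi\rangle$ for $\varphi\in C_c^\infty(\mathbb R^n)$, where $P^t\varphi\in C_c^\infty(\mathbb R^n)$ is given by $\langle P\psi,\varphi\rangle=\int\psi\,P^t\varphi\,dy$ for all $\psi\in C_c^\infty(\mathbb R^n)$ (that $P^t\varphi$ exists as a compactly supported smooth function is part of the claim). For $s\in\mathbb R$, $H^s(\mathbb R^n)$ is the space of $u\in\mathcal S'(\mathbb R^n)$ with $\|u\|_s=\|\langle\xi\rangle^s\hat u\|_{L^2}<\infty$, and $H^s_c(\mathbb R^n)$ is its subspace of elements with compact support; $L^2_c$ is the space of compactly supported $L^2$ functions. **Theorem.** Let $P\in\Psi DO^m_{cl}(\mathbb R^n)$ be properly supported. 1. For every $s\in\mathbb R$, $u\mapsto Pu$ is a well-defined linear map $H^s_c(\mathbb R^n)\to H^{s-m}_c(\mathbb R^n)$, and it is continuous: for every compact $C\subset\mathbb R^n$ there are a compact $C'\subset\mathbb R^n$ and a constant $A$ such that for every $u\in H^s_c(\mathbb R^n)$ with $\operatorname{supp}u\subset C$, $$\operatorname{supp}(Pu)\subset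 C'\quad\text{and}\quad\|Pu\|_{s-m}\le A\,\|u\|_s.$$ 2. In particular, if $m=0$, then $f\mapsto Pf$ is a well-defined linear map $L^2_c(\mathbb R^n)\to L^2_c(\mathbb R^n)$, and it is continuous: for every compact $C$ there are a compact $C'$ and a constant $A$ such that for every $f\in L^2_c(\mathbb R^n)$ vanishing a.e. outside $C$, $Pf$ vanishes a.e. outside $C'$ and $\|Pf\|_{L^2}\le A\,\|f\|_{L^2}$. -/

import Mathlib

open MeasureTheory Filter Topology TopologicalSpace SchwartzMap Distribution TemperedDistribution
open scoped ContDiff Distributions FourierTransform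

noncomputable section

namespace PseudoDiff

/-- The Euclidean space `ℝⁿ`. -/
abbrev Eucl (n : ℕ) : Type := EuclideanSpace ℝ (Fin n)

/-- The test functions `C_c^∞(ℝⁿ)`, complex valued. -/
abbrev Test (n : ℕ) : Type := 𝓓((⊤ : Opens (Eucl n)), ℂ)

/-- The test functions `C_c^∞(ℝⁿ × ℝⁿ)`, complex valued. -/
abbrev Test2 (n : ℕ) : Type := 𝓓((⊤ : Opens (Eucl n × Eucl n)), ℂ)

/-- The distributions `𝓓'(ℝⁿ)`: the continuous complex linear functionals on `C_c^∞(ℝⁿ)`. -/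
abbrev Distr (n : ℕ) : Type := Test n →L[ℂ] ℂ

/-- The distributions `𝓓'(ℝⁿ × ℝⁿ)`; the Schwartz kernels live here. -/
abbrev Kernel2 (n : ℕ) : Type := Test2 n →L[ℂ] ℂ

/-- The Japanese bracket `⟨ξ⟩ = (1 + |ξ|²)^{1/2}`. -/
def bracket {n : ℕ} (ξ : Eucl n) : ℝ := (1 + ‖ξ‖ ^ 2) ^ (1 / 2 : ℝ)

/-! ### Symbols -/

/-- The symbol class `S^m(X; ℝⁿ)`: `a` is smooth on `X × ℝⁿ`, and for all orders of
differentiation `i` in `x` and `j` in `ξ`, the derivatives are `O(⟨ξ⟩^{m-j})` uniformly for `x` in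
compact sets. -/
def IsSymbol {X : Type*} [NormedAddCommGroup X] [NormedSpace ℝ X] {n : ℕ}
    (m : ℝ) (a : X → Eucl n → ℂ) : Prop :=
  ContDiff ℝ ∞ (fun z : X × Eucl n => a z.1 z.2) ∧
  ∀ (i j : ℕ) (C : Set X), IsCompact C → ∃ A : ℝ, ∀ x ∈ C, ∀ ξ : Eucl n,
    ‖iteratedFDeriv ℝ i (fun x' : X => iteratedFDeriv ℝ j (a x') ξ) x‖
      ≤ A * bracket ξ ^ (m - j)

/-- `φ` is a smooth compactly supported function on `ℝⁿ` that equals `1` near the origin. -/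
def IsCutoff {n : ℕ} (φ : Eucl n → ℝ) : Prop :=
  ContDiff ℝ ∞ φ ∧ HasCompactSupport φ ∧ ∀ᶠ ξ in 𝓝 0, φ ξ = 1

/-- `p(x, ξ)` is smooth for `ξ ≠ 0` and positively homogeneous of degree `d` in `ξ`. -/
def IsHomogeneousSymbol {n : ℕ} (d : ℝ) (p : Eucl n → Eucl n → ℂ) : Prop :=
  ContDiffOn ℝ ∞ (fun z : Eucl n × Eucl n => p z.1 z.2) {z | z.2 ≠ 0} ∧
  ∀ (x ξ : Eucl n) (t : ℝ), ξ ≠ 0 → 0 < t → p x (t • ξ) = ((t ^ d : ℝ) : ℂ) * p x ξ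

/-- A classical symbol of order `m`: a symbol with an asymptotic expansion
`a ∼ ∑ (1 - φ) a_{m-j}` in homogeneous terms of degrees `m, m - 1, m - 2, …`. -/
def IsClassicalSymbol {n : ℕ} (m : ℝ) (a : Eucl n → Eucl n → ℂ) : Prop :=
  IsSymbol m a ∧
  ∃ (p : ℕ → Eucl n → Eucl n → ℂ) (φ : Eucl n → ℝ), IsCutoff φ ∧
    (∀ j : ℕ, IsHomogeneousSymbol (m - j) (p j)) ∧
    ∀ N : ℕ, IsSymbol (m - N)
      (fun x ξ => a x ξ - ∑ j ∈ Finset.range N, ((1 - φ ξ : ℝ) : ℂ) * p j x ξ)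

/-! ### Oscillatory integrals and pseudo-differential operators -/

/-- The regularized pairing of the oscillatory integral `∫ e^{i⟨x-y,ξ⟩} a(x,y,ξ) dξ` with the test
function `ψ(x,y)`: the integral over all `((x, y), ξ)` with the amplitude cut off by `χ(ε ξ)`. The
integrand is smooth and compactly supported for `ε ≠ 0`. -/
def regularizedPairing {n : ℕ} (a : Eucl n × Eucl n → Eucl n → ℂ) (χ : Eucl n → ℝ)
    (ψ : Test2 n) (ε : ℝ) : ℂ :=
  ∫ w : (Eucl n × Eucl n) × Eucl n,
    Complex.exp (Complex.I * (inner ℝ (w.1.1 - w.1.2) w.2 : ℝ)) * (χ (ε • w.2) : ℂ)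
      * a w.1 w.2 * ψ w.1

/-- The value at `ψ` of the distribution `∫ e^{i⟨x-y,ξ⟩} a(x,y,ξ) dξ` on `ℝⁿ × ℝⁿ` is `c`: for every
cutoff `χ` the regularized pairings converge to `c` as `ε → 0⁺`. -/
def HasOscPairing {n : ℕ} (a : Eucl n × Eucl n → Eucl n → ℂ) (ψ : Test2 n) (c : ℂ) : Prop :=
  ∀ χ : Eucl n → ℝ, IsCutoff χ →
    Tendsto (regularizedPairing a χ ψ) (𝓝[>] (0 : ℝ)) (𝓝 c)

/-- `K` is the kernel of an operator of the class `ΨDO^m(ℝⁿ)`: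
`K(x,y) = ∫ e^{i⟨x-y,ξ⟩} a(x,y,ξ) dξ` for a symbol `a ∈ S^m(ℝⁿ × ℝⁿ; ℝⁿ)`. -/
def IsPseudoDiffKernel {n : ℕ} (m : ℝ) (K : Kernel2 n) : Prop :=
  ∃ a : Eucl n × Eucl n → Eucl n → ℂ, IsSymbol m a ∧ ∀ ψ, HasOscPairing a ψ (K ψ)

/-- `K(x,y) - ∫ e^{i⟨x-y,ξ⟩} a(x,y,ξ) dξ` is a smooth function `R(x,y)`. -/
def HasAmplitudeModSmooth {n : ℕ} (K : Kernel2 n) (a : Eucl n × Eucl n → Eucl n → ℂ) : Prop :=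
  ∃ R : Eucl n × Eucl n → ℂ, ContDiff ℝ ∞ R ∧ ∀ ψ, HasOscPairing a ψ (K ψ - ∫ z, R z * ψ z)

/-- `K` is the kernel of an operator of the class `ΨDO_cl^m(ℝⁿ)`: it is the kernel of a
pseudo-differential operator of order `m` whose total left symbol `a(x,ξ)` or total right symbol
`b(y,ξ)` (which are defined by quantization up to smooth kernels) is classical of order `m`. -/
def IsClassicalPseudoDiffKernel {n : ℕ} (m : ℝ) (K : Kernel2 n) : Prop :=
  IsPseudoDiffKernel m K ∧
  ((∃ a : Eucl n → Eucl n → ℂ, IsClassicalSymbol m a ∧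
      HasAmplitudeModSmooth K (fun z ξ => a z.1 ξ)) ∨
   (∃ b : Eucl n → Eucl n → ℂ, IsClassicalSymbol m b ∧
      HasAmplitudeModSmooth K (fun z ξ => b z.2 ξ)))

/-- `K` is properly supported: both projections `supp K → ℝⁿ` are proper maps. -/
def IsProperlySupported {n : ℕ} (K : Kernel2 n) : Prop :=
  ∀ C : Set (Eucl n), IsCompact C →
    IsCompact (dsupport K ∩ Prod.fst ⁻¹' C) ∧ IsCompact (dsupport K ∩ Prod.snd ⁻¹' C)

/-- The test function `φ(x) u(y)` on `ℝⁿ × ℝⁿ`. -/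
def tensor {n : ℕ} (φ u : Test n) : Test2 n where
  toFun z := φ z.1 * u z.2
  contDiff' := (φ.contDiff.comp contDiff_fst).mul (u.contDiff.comp contDiff_snd)
  hasCompactSupport' := by
    refine HasCompactSupport.intro (φ.hasCompactSupport.isCompact.prod
      u.hasCompactSupport.isCompact) ?_
    intro z hz
    by_cases h1 : z.1 ∈ tsupport φ
    · have h2 : z.2 ∉ tsupport u := fun h => hz ⟨h1, h⟩
      rw [image_eq_zero_of_notMem_tsupport h2, mul_zero]
    · rw [image_eq_zero_of_notMem_tsupport h1, zero_mul]
  tsupport_subset' := fun _ _ => trivial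

/-- The linear operator `P : C_c^∞(ℝⁿ) → 𝓓'(ℝⁿ)` has Schwartz kernel `K`:
`⟨P u, φ⟩ = ⟨K(x,y), φ(x) u(y)⟩`. -/
def HasSchwartzKernel {n : ℕ} (P : Test n →ₗ[ℂ] Distr n) (K : Kernel2 n) : Prop :=
  ∀ u φ : Test n, P u φ = K (tensor φ u)

/-! ### The action on compactly supported distributions -/

/-- A test function, regarded as a Schwartz function. -/
def toSchwartz {n : ℕ} (g : Test n) : 𝓢(Eucl n, ℂ) :=
  g.hasCompactSupport.toSchwartzMap g.contDiff

/-- The test function `g` is the transpose `P^t φ`: `⟨P ψ, φ⟩ = ∫ ψ g` for all test functions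
`ψ`. -/
def IsTransposeApply {n : ℕ} (P : Test n →ₗ[ℂ] Distr n) (φ g : Test n) : Prop :=
  ∀ ψ : Test n, P ψ φ = ∫ y, ψ y * g y

/-- `v = P u` for (tempered, in the use below compactly supported) distributions `u` and `v`:
for every test function `φ` the transpose `P^t φ` is a test function, and
`⟨v, φ⟩ = ⟨u, P^t φ⟩`. By density of the test functions, `v` is determined by `P` and `u`. -/
def IsImage {n : ℕ} (P : Test n →ₗ[ℂ] Distr n) (u v : 𝓢'(Eucl n, ℂ)) : Prop :=
  ∀ φ : Test n, ∃ g : Test n, IsTransposeApply P φ g ∧ v (toSchwartz φ) = u (toSchwartz g)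

/-! ### Sobolev spaces -/

theorem dsupport_add_subset {n : ℕ} (u v : 𝓢'(Eucl n, ℂ)) :
    dsupport (u + v) ⊆ dsupport u ∪ dsupport v := by
  intro x hx
  by_contra h
  rw [Set.mem_union, not_or] at h
  obtain ⟨hu, hv⟩ := h
  obtain ⟨s, hs, hso, hxs⟩ := (notMem_dsupport_iff x).1 hu
  obtain ⟨t, ht, hto, hxt⟩ := (notMem_dsupport_iff x).1 hv
  refine (notMem_dsupport_iff x).2 ⟨s ∩ t, ?_, hso.inter hto, hxs, hxt⟩ hx
  intro f hf
  have h1 := hs f (hf.trans Set.inter_subset_left)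
  have h2 := ht f (hf.trans Set.inter_subset_right)
  change u f + v f = 0
  rw [h1, h2, add_zero]

theorem dsupport_smul_subset {n : ℕ} (c : ℂ) (u : 𝓢'(Eucl n, ℂ)) :
    dsupport (c • u) ⊆ dsupport u := by
  refine dsupport_subset_dsupport fun s _ hs f hf => ?_
  change c • u f = 0
  rw [hs f hf, smul_zero]

theorem dsupport_zero_eq {n : ℕ} : dsupport (0 : 𝓢'(Eucl n, ℂ)) = ∅ := by
  refine Set.eq_empty_of_forall_notMem fun x => ?_
  exact (notMem_dsupport_iff x).2 ⟨Set.univ, fun _ _ => rfl, isOpen_univ, Set.mem_univ x⟩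

/-- The space `H_c^s(ℝⁿ)` of all `u ∈ H^s(ℝⁿ)` whose support is compact. Here `H^s(ℝⁿ)` consists of
the tempered distributions with `(1 + |ξ|²)^{s/2} û(ξ) ∈ L²`. -/
def Hc (n : ℕ) (s : ℝ) : Submodule ℂ 𝓢'(Eucl n, ℂ) where
  carrier := {u | MemSobolev s 2 u ∧ IsCompact (dsupport u)}
  zero_mem' := ⟨memSobolev_fun_zero (Eucl n) ℂ s 2, by
    rw [dsupport_zero_eq]; exact isCompact_empty⟩
  add_mem' := fun {u v} hu hv => ⟨hu.1.add hv.1,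
    (hu.2.union hv.2).of_isClosed_subset isClosed_dsupport (dsupport_add_subset u v)⟩
  smul_mem' := fun c u hu => ⟨hu.1.smul c,
    hu.2.of_isClosed_subset isClosed_dsupport (dsupport_smul_subset c u)⟩

open scoped Classical in
/-- The norm of `H^s(ℝⁿ)`: the `L²` norm of `(1 + |ξ|²)^{s/2} û(ξ)`, equivalently of the inverse
Fourier transform of this function (and zero outside `H^s`). -/
def sobolevNorm {n : ℕ} (s : ℝ) (u : 𝓢'(Eucl n, ℂ)) : ℝ :=
  if h : MemSobolev s 2 u then ‖h.choose‖ else 0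

theorem sobolevNorm_eq {n : ℕ} {s : ℝ} {u : 𝓢'(Eucl n, ℂ)}
    {f : Lp ℂ 2 (volume : Measure (Eucl n))}
    (h : besselPotential (Eucl n) ℂ s u = (f : 𝓢'(Eucl n, ℂ))) : sobolevNorm s u = ‖f‖ := by
  have hu : MemSobolev s 2 u := ⟨f, h⟩
  have hinj : Function.Injective
      (Lp.toTemperedDistributionCLM ℂ (volume : Measure (Eucl n)) 2) :=
    LinearMap.ker_eq_bot.1 Lp.ker_toTemperedDistributionCLM_eq_bot
  have : hu.choose = f := hinj (by simpa using hu.choose_spec.symm.trans h)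
  rw [sobolevNorm, dif_pos hu, this]

/-- Continuity of a linear map `H_c^s → H_c^t`: for every compact `C` there are a compact `C'` and a
constant `A` such that every `u` supported in `C` is mapped to an element supported in `C'`, with
`‖T u‖_t ≤ A ‖u‖_s`. -/
def IsContinuousHc {n : ℕ} {s t : ℝ} (T : Hc n s →ₗ[ℂ] Hc n t) : Prop :=
  ∀ C : Set (Eucl n), IsCompact C → ∃ C' : Set (Eucl n), IsCompact C' ∧ ∃ A : ℝ,
    ∀ u : Hc n s, dsupport (u : 𝓢'(Eucl n, ℂ)) ⊆ C →
      dsupport (T u : 𝓢'(Eucl n, ℂ)) ⊆ C' ∧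
      sobolevNorm t (T u : 𝓢'(Eucl n, ℂ)) ≤ A * sobolevNorm s (u : 𝓢'(Eucl n, ℂ))

/-- The space `L²(ℝⁿ)` of complex functions. -/
abbrev L2 (n : ℕ) : Type := Lp ℂ 2 (volume : Measure (Eucl n))

/-- The `L²` function `f` vanishes almost everywhere outside `C`. -/
def SupportedIn {n : ℕ} (f : L2 n) (C : Set (Eucl n)) : Prop := ∀ᵐ x, x ∉ C → f x = 0

/-- The space `L_c²(ℝⁿ)` of the `L²` functions with compact support. -/
def L2c (n : ℕ) : Submodule ℂ (L2 n) where
  carrier := {f | ∃ C : Set (Eucl n), IsCompact C ∧ SupportedIn f C}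
  zero_mem' := ⟨∅, isCompact_empty, by
    filter_upwards [Lp.coeFn_zero ℂ 2 (volume : Measure (Eucl n))] with x hx _
    exact hx⟩
  add_mem' := by
    rintro f g ⟨C, hC, hf⟩ ⟨D, hD, hg⟩
    refine ⟨C ∪ D, hC.union hD, ?_⟩
    unfold SupportedIn at hf hg ⊢
    filter_upwards [hf, hg, Lp.coeFn_add f g] with x h1 h2 h3 hx
    rw [Set.mem_union, not_or] at hx
    rw [h3, Pi.add_apply, h1 hx.1, h2 hx.2, add_zero]
  smul_mem' := by
    rintro c f ⟨C, hC, hf⟩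
    refine ⟨C, hC, ?_⟩
    unfold SupportedIn at hf ⊢
    filter_upwards [hf, Lp.coeFn_smul c f] with x h1 h3 hx
    rw [h3, Pi.smul_apply, h1 hx, smul_zero]

/-- Continuity of a linear map `L_c² → L_c²`: for every compact `C` there are a compact `C'` and a
constant `A` such that every `f` supported in `C` is mapped to an element supported in `C'`, with
`‖T f‖ ≤ A ‖f‖` in the `L²` norms. -/
def IsContinuousL2c {n : ℕ} (T : L2c n →ₗ[ℂ] L2c n) : Prop :=
  ∀ C : Set (Eucl n), IsCompact C → ∃ C' : Set (Eucl n), IsCompact C' ∧ ∃ A : ℝ,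
    ∀ f : L2c n, SupportedIn (f : L2 n) C →
      SupportedIn (T f : L2 n) C' ∧ ‖(T f : L2 n)‖ ≤ A * ‖(f : L2 n)‖

end PseudoDiff

end

open PseudoDiff

open MeasureTheory Filter Topology TopologicalSpace SchwartzMap Distribution TemperedDistribution
open scoped ContDiff Distributions FourierTransform

noncomputable section

namespace PseudoDiff

/-! On inputs supported in a fixed compact set, proper support allows the amplitude `a` to be
replaced by `b = θ a`, with `θ` a compactly supported cutoff in `(x,y)`, and such an operator
becomes an honest integral operator on the Fourier side. The Fourier transform of `b(·,·,ξ)` in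
`(x,y)` is rapidly decreasing, with constants `O(⟨ξ⟩^m)`, and the phase `e^{i⟨x-y,ξ⟩}` only shifts
both frequencies by `ξ/2π`. So the matrix element `freqAmp b ξ η ζ` is concentrated at `η ≈ ζ ≈
ξ/2π`. There the weight `⟨η⟩^{s-m} ⟨ζ⟩^{-s}` compensates `⟨ξ⟩^m`, up to powers that the rapid decay
absorbs by Peetre's inequality. Integrating over `ξ` gives a weighted kernel dominated by the
integrable convolution kernel `decay (η - ζ)` (`IsAmplitude.exists_norm_freqKernel_le`), hence a
bounded form on `L²` (`lintegral_decay_sub_mul_le`); Riesz representation turns the form into an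
operator (`IsAmplitude.exists_L2_bound`).

To connect this with the given operator, `IsAmplitude.eq_of_hasOscPairing` identifies the
regularized oscillatory integral with the form of `freqKernel`, and `IsAmplitude.exists_transpose`
shows that the transpose produces test functions. In `exists_bounded_image` the cutoff is `θ = κ(y)
Θ(x,y)` with `κ = 1` near the given compact set; the transposes of the original and the localized
operator then differ by the factor `κ`, which distributions supported in that set do not see. An
image is determined by its values on test functions, so the local constructions glue to a linear
map. For `m = 0` the `L²` statement is the case `s = 0`. -/

/-! ### Weights -/

/-- The weight `1 + |x|²`. -/
def bracketSq {n : ℕ} (x : Eucl n) : ℝ := 1 + ‖x‖ ^ 2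

theorem bracketSq_pos {n : ℕ} (x : Eucl n) : 0 < bracketSq x := by
  unfold bracketSq; positivity

theorem one_le_bracketSq {n : ℕ} (x : Eucl n) : 1 ≤ bracketSq x := by
  unfold bracketSq; nlinarith [sq_nonneg ‖x‖]

theorem bracketSq_neg {n : ℕ} (x : Eucl n) : bracketSq (-x) = bracketSq x := by
  simp [bracketSq]

theorem continuous_bracketSq_rpow {n : ℕ} (r : ℝ) :
    Continuous fun x : Eucl n => bracketSq x ^ r := by
  have : Continuous fun x : Eucl n => bracketSq x := by unfold bracketSq; fun_prop
  exact this.rpow_const fun x => Or.inl (bracketSq_pos x).ne'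

theorem bracketSq_rpow_pos {n : ℕ} (x : Eucl n) (r : ℝ) : 0 < bracketSq x ^ r :=
  Real.rpow_pos_of_pos (bracketSq_pos x) r

theorem bracket_rpow {n : ℕ} (x : Eucl n) (r : ℝ) : bracket x ^ r = bracketSq x ^ (r / 2) := by
  unfold bracket bracketSq
  rw [← Real.rpow_mul (by positivity)]
  congr 1
  ring

theorem bracketSq_add_le {n : ℕ} (x y : Eucl n) :
    bracketSq (x + y) ≤ 2 * bracketSq x * bracketSq y := by
  unfold bracketSq
  have h := norm_add_le x y
  have h2 : ‖x + y‖ ^ 2 ≤ (‖x‖ + ‖y‖) ^ 2 := by gcongr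
  nlinarith [sq_nonneg (‖x‖ - ‖y‖), sq_nonneg (‖x‖ * ‖y‖), sq_nonneg ‖x‖, sq_nonneg ‖y‖]

/-- Comparison of real powers of two positive numbers, each bounded by a multiple of the other. -/
theorem rpow_le_of_le_mul {a b c : ℝ} (ha : 0 < a) (hb : 0 < b) (hc : 0 < c)
    (hab : a ≤ c * b) (hba : b ≤ c * a) (r : ℝ) : a ^ r ≤ c ^ |r| * b ^ r := by
  rcases le_or_gt 0 r with hr | hr
  · rw [abs_of_nonneg hr, ← Real.mul_rpow hc.le hb.le]
    exact Real.rpow_le_rpow ha.le hab hr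
  · rw [abs_of_neg hr]
    have h1 : b * c⁻¹ ≤ a := by
      rw [← div_eq_mul_inv, div_le_iff₀ hc]; linarith
    calc a ^ r ≤ (b * c⁻¹) ^ r := Real.rpow_le_rpow_of_nonpos (by positivity) h1 hr.le
      _ = c ^ (-r) * b ^ r := by
        rw [Real.mul_rpow hb.le (by positivity), Real.inv_rpow hc.le, ← Real.rpow_neg hc.le,
          mul_comm]

/-- Peetre's inequality. -/
theorem bracketSq_rpow_le {n : ℕ} (x y : Eucl n) (r : ℝ) :
    bracketSq x ^ r ≤ 2 ^ |r| * bracketSq (x - y) ^ |r| * bracketSq y ^ r := by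
  have h1 := bracketSq_pos x
  have h2 := bracketSq_pos y
  have h3 := bracketSq_pos (x - y)
  rw [← Real.mul_rpow (by norm_num) h3.le]
  refine rpow_le_of_le_mul h1 h2 (by positivity) ?_ ?_ r
  · simpa using bracketSq_add_le (x - y) y
  · have := bracketSq_add_le (-(x - y)) x
    rw [bracketSq_neg] at this
    simpa using this

/-- The phase `e^{i⟨x-y,ξ⟩}` has frequency `ξ/2π` in the normalization `e^{2πi⟨x,η⟩}` of the Fourier
transform; this carries symbol bounds over to the rescaled variable. -/
theorem bracketSq_rpow_two_pi_smul_le {n : ℕ} (x : Eucl n) (r : ℝ) :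
    bracketSq x ^ r ≤ ((2 * Real.pi) ^ 2) ^ |r| * bracketSq ((2 * Real.pi)⁻¹ • x) ^ r := by
  have hpi : 1 ≤ (2 * Real.pi) ^ 2 := by nlinarith [Real.pi_gt_three]
  refine rpow_le_of_le_mul (bracketSq_pos _) (bracketSq_pos _) (by positivity) ?_ ?_ r
  · unfold bracketSq
    have h1 : ((2 * Real.pi) * ‖(2 * Real.pi)⁻¹ • x‖) ^ 2 = ‖x‖ ^ 2 := by
      rw [norm_smul, norm_inv, Real.norm_eq_abs, abs_of_pos (by positivity), ← mul_assoc,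
        mul_inv_cancel₀ (by positivity), one_mul]
    rw [mul_add, ← mul_pow _ ‖_‖, h1]
    linarith
  · have h2 : bracketSq ((2 * Real.pi)⁻¹ • x) ≤ bracketSq x := by
      unfold bracketSq
      rw [norm_smul, norm_inv, Real.norm_eq_abs, abs_of_pos (by positivity)]
      have : (2 * Real.pi)⁻¹ ≤ 1 := inv_le_one_of_one_le₀ (by nlinarith [Real.pi_gt_three])
      have : (2 * Real.pi)⁻¹ * ‖x‖ ≤ ‖x‖ := mul_le_of_le_one_left (norm_nonneg _) this
      gcongr
    nlinarith [bracketSq_pos x]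

/-- An integrable power of the weight. -/
def decay {n : ℕ} (x : Eucl n) : ℝ := bracketSq x ^ (-((n : ℝ) + 1) / 2)

theorem decay_pos {n : ℕ} (x : Eucl n) : 0 < decay x := bracketSq_rpow_pos x _

theorem decay_le_one {n : ℕ} (x : Eucl n) : decay x ≤ 1 :=
  Real.rpow_le_one_of_one_le_of_nonpos (one_le_bracketSq x)
    (div_nonpos_of_nonpos_of_nonneg (by linarith [n.cast_nonneg (α := ℝ)]) (by norm_num))

theorem continuous_decay {n : ℕ} : Continuous (decay (n := n)) := continuous_bracketSq_rpow _

theorem integrable_decay {n : ℕ} : Integrable (decay (n := n)) := by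
  have := integrable_rpow_neg_one_add_norm_sq (E := Eucl n) (μ := volume) (r := (n : ℝ) + 1)
    (by simp)
  exact this

/-! ### Kernels dominated by a convolution -/

/-- Cauchy–Schwarz for the Lebesgue integral. -/
theorem lintegral_enorm_mul_le {α : Type*} [MeasurableSpace α] {μ : Measure α} {f g : α → ℂ}
    (hf : StronglyMeasurable f) (hg : StronglyMeasurable g) :
    ∫⁻ x, ‖f x‖ₑ * ‖g x‖ₑ ∂μ ≤ eLpNorm f 2 μ * eLpNorm g 2 μ := by
  have h := ENNReal.lintegral_mul_le_Lp_mul_Lq μ (p := 2) (q := 2)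
    (Real.HolderConjugate.two_two) hf.enorm.aemeasurable hg.enorm.aemeasurable
  rw [eLpNorm_eq_lintegral_rpow_enorm_toReal (by norm_num) (by norm_num),
    eLpNorm_eq_lintegral_rpow_enorm_toReal (by norm_num) (by norm_num)]
  simpa using h

/-- Young's inequality `L¹ * L² ⊂ L²` in bilinear form: with `p = η - ζ` held fixed, Cauchy–Schwarz
in `ζ` and translation invariance give a bound independent of `p`, which is then integrated against
`decay p`. -/
theorem lintegral_decay_sub_mul_le {n : ℕ} {f g : Eucl n → ℂ}
    (hf : StronglyMeasurable f) (hg : StronglyMeasurable g) :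
    ∫⁻ z : Eucl n × Eucl n, ‖decay (z.1 - z.2)‖ₑ * (‖f z.1‖ₑ * ‖g z.2‖ₑ)
      ≤ (∫⁻ x : Eucl n, ‖decay x‖ₑ) * (eLpNorm f 2 volume * eLpNorm g 2 volume) := by
  have hd : Measurable fun x : Eucl n => ‖decay x‖ₑ := continuous_decay.measurable.enorm
  have hd0 : Measurable (decay (n := n)) := continuous_decay.measurable
  have hfm := hf.measurable
  have hgm := hg.measurable
  have hmeas : Measurable fun z : Eucl n × Eucl n =>
      ‖decay (z.1 - z.2)‖ₑ * (‖f z.1‖ₑ * ‖g z.2‖ₑ) := by fun_prop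
  calc ∫⁻ z : Eucl n × Eucl n, ‖decay (z.1 - z.2)‖ₑ * (‖f z.1‖ₑ * ‖g z.2‖ₑ)
      = ∫⁻ ζ : Eucl n, ∫⁻ η : Eucl n, ‖decay (η - ζ)‖ₑ * (‖f η‖ₑ * ‖g ζ‖ₑ) := by
        rw [Measure.volume_eq_prod]
        exact lintegral_prod_symm' _ hmeas
    _ = ∫⁻ ζ : Eucl n, ∫⁻ p : Eucl n, ‖decay p‖ₑ * (‖f (p + ζ)‖ₑ * ‖g ζ‖ₑ) := by
        refine lintegral_congr fun ζ => ?_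
        rw [← lintegral_add_right_eq_self _ ζ]
        simp
    _ = ∫⁻ p : Eucl n, ∫⁻ ζ : Eucl n, ‖decay p‖ₑ * (‖f (p + ζ)‖ₑ * ‖g ζ‖ₑ) := by
        refine lintegral_lintegral_swap (Measurable.aemeasurable ?_)
        unfold Function.uncurry
        fun_prop
    _ ≤ ∫⁻ p : Eucl n, ‖decay p‖ₑ * (eLpNorm f 2 volume * eLpNorm g 2 volume) := by
        refine lintegral_mono fun p => ?_
        rw [lintegral_const_mul _ (by fun_prop)]
        gcongr
        have hp : MeasurePreserving (fun x : Eucl n => p + x) := measurePreserving_add_left volume p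
        have := lintegral_enorm_mul_le (μ := volume)
          (hf.comp_measurable hp.measurable) hg
        rwa [eLpNorm_comp_measurePreserving hf.aestronglyMeasurable hp] at this
    _ = _ := lintegral_mul_const _ hd

/-! ### Compactly supported amplitudes -/

instance instIsAddHaarMeasureProd {n : ℕ} :
    (volume : Measure (Eucl n × Eucl n)).IsAddHaarMeasure :=
  inferInstanceAs ((volume : Measure (Eucl n)).prod (volume : Measure (Eucl n))).IsAddHaarMeasure

/-- An amplitude `b(x,y,ξ)` of order `m` that vanishes for `(x,y)` outside the compact set `S`. -/
structure IsAmplitude {n : ℕ} (m : ℝ) (b : Eucl n × Eucl n → Eucl n → ℂ)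
    (S : Set (Eucl n × Eucl n)) : Prop where
  contDiff : ContDiff ℝ ∞ fun w : (Eucl n × Eucl n) × Eucl n => b w.1 w.2
  isCompact : IsCompact S
  eq_zero : ∀ z ∉ S, ∀ ξ, b z ξ = 0
  bound : ∀ i : ℕ, ∃ A : ℝ, ∀ z ξ,
    ‖iteratedFDeriv ℝ i (fun z => b z ξ) z‖ ≤ A * bracketSq ξ ^ (m / 2)

/-- Leibniz' rule, with the symbol estimates on the compact set `tsupport θ`; only those without
`ξ`-derivatives enter. -/
theorem IsSymbol.isAmplitude {n : ℕ} {m : ℝ} {a : Eucl n × Eucl n → Eucl n → ℂ}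
    (ha : IsSymbol m a) {θ : Eucl n × Eucl n → ℝ} (hθ : ContDiff ℝ ∞ θ)
    (hc : HasCompactSupport θ) :
    IsAmplitude m (fun z ξ => (θ z : ℂ) * a z ξ) (tsupport θ) := by
  have hθ' : ContDiff ℝ ∞ fun z => (θ z : ℂ) := Complex.ofRealCLM.contDiff.comp hθ
  have haξ : ∀ ξ, ContDiff ℝ ∞ fun z => a z ξ := fun ξ =>
    ha.1.comp (contDiff_id.prodMk contDiff_const)
  have hsupp : ∀ z ∉ tsupport θ, (θ z : ℂ) = 0 := fun z hz => by
    rw [image_eq_zero_of_notMem_tsupport hz, Complex.ofReal_zero]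
  refine ⟨(hθ'.comp contDiff_fst).mul ha.1, hc, fun z hz ξ => ?_, fun i => ?_⟩
  · rw [hsupp z hz, zero_mul]
  · have h1 : ∀ j : ℕ, ∃ A : ℝ, ∀ z, ‖iteratedFDeriv ℝ j (fun z => (θ z : ℂ)) z‖ ≤ A := by
      intro j
      have hcs : HasCompactSupport fun z => (θ z : ℂ) := hc.comp_left Complex.ofReal_zero
      exact (hθ'.continuous_iteratedFDeriv (by exact_mod_cast le_top)).bounded_above_of_compact_support
        (hcs.iteratedFDeriv j)
    have h2 : ∀ j : ℕ, ∃ A : ℝ, ∀ z ∈ tsupport θ, ∀ ξ,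
        ‖iteratedFDeriv ℝ j (fun z => a z ξ) z‖ ≤ A * bracketSq ξ ^ (m / 2) := by
      intro j
      obtain ⟨A, hA⟩ := ha.2 j 0 (tsupport θ) hc
      refine ⟨A, fun z hz ξ => ?_⟩
      have h := hA z hz ξ
      rw [Nat.cast_zero, sub_zero, bracket_rpow] at h
      refine le_of_eq_of_le ?_ h
      have : (fun x' => iteratedFDeriv ℝ 0 (a x') ξ)
          = (continuousMultilinearCurryFin0 ℝ (Eucl n) ℂ).symm ∘ fun z => a z ξ := by
        ext1 x'
        rw [iteratedFDeriv_zero_eq_comp]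
        rfl
      rw [this, LinearIsometryEquiv.norm_iteratedFDeriv_comp_left]
    choose A1 hA1 using h1
    choose A2 hA2 using h2
    refine ⟨∑ j ∈ Finset.range (i + 1), (i.choose j : ℝ) * |A1 j| * |A2 (i - j)|, fun z ξ => ?_⟩
    by_cases hz : z ∈ tsupport θ
    · refine (norm_iteratedFDeriv_mul_le hθ' (haξ ξ) z (n := i) (by exact_mod_cast le_top)).trans ?_
      rw [Finset.sum_mul]
      refine Finset.sum_le_sum fun j _ => ?_
      rw [mul_assoc _ |A2 _|]
      gcongr
      · exact (hA1 j z).trans (le_abs_self _)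
      · refine (hA2 _ z hz ξ).trans ?_
        gcongr
        · exact (bracketSq_rpow_pos ξ _).le
        · exact le_abs_self _
    · have : iteratedFDeriv ℝ i (fun z => (θ z : ℂ) * a z ξ) z = 0 := by
        by_contra hne
        refine hz ?_
        have := support_iteratedFDeriv_subset (𝕜 := ℝ) (f := fun z => (θ z : ℂ) * a z ξ) i hne
        refine closure_minimal ?_ (isClosed_tsupport θ) this
        intro y hy
        by_contra hy'
        exact hy (by simp only [hsupp y hy', zero_mul])
      rw [this, norm_zero]
      have := bracketSq_rpow_pos ξ (m / 2)
      positivity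

/-! ### Fourier transform of an amplitude in the space variables -/

/-- The bilinear form `⟨x, p⟩ - ⟨y, q⟩`. -/
def pairForm (n : ℕ) : (Eucl n × Eucl n) →L[ℝ] (Eucl n × Eucl n) →L[ℝ] ℝ :=
  (innerSL ℝ).bilinearComp (ContinuousLinearMap.fst ℝ (Eucl n) (Eucl n))
      (ContinuousLinearMap.fst ℝ (Eucl n) (Eucl n))
    - (innerSL ℝ).bilinearComp (ContinuousLinearMap.snd ℝ (Eucl n) (Eucl n))
      (ContinuousLinearMap.snd ℝ (Eucl n) (Eucl n))

theorem pairForm_apply {n : ℕ} (z w : Eucl n × Eucl n) :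
    pairForm n z w = inner ℝ z.1 w.1 - inner ℝ z.2 w.2 := rfl

/-- The partial Fourier transform of an amplitude in `(x,y)`, with respect to `pairForm`. -/
def ampFourier {n : ℕ} (b : Eucl n × Eucl n → Eucl n → ℂ) (ξ : Eucl n) (w : Eucl n × Eucl n) : ℂ :=
  VectorFourier.fourierIntegral Real.fourierChar volume
    (ContinuousLinearMap.toLinearMap₁₂ (pairForm n)) (fun z => b z ξ) w

theorem ampFourier_eq {n : ℕ} (b : Eucl n × Eucl n → Eucl n → ℂ) (ξ : Eucl n)
    (w : Eucl n × Eucl n) :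
    ampFourier b ξ w = ∫ z, Real.fourierChar (-(pairForm n z w)) • b z ξ := rfl

section

variable {n : ℕ} {m : ℝ} {b : Eucl n × Eucl n → Eucl n → ℂ} {S : Set (Eucl n × Eucl n)}

theorem IsAmplitude.contDiff_fst (hb : IsAmplitude m b S) (ξ : Eucl n) :
    ContDiff ℝ ∞ fun z => b z ξ :=
  hb.contDiff.comp (contDiff_id.prodMk contDiff_const)

theorem IsAmplitude.continuous (hb : IsAmplitude m b S) :
    Continuous fun w : (Eucl n × Eucl n) × Eucl n => b w.1 w.2 := hb.contDiff.continuous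

theorem IsAmplitude.hasCompactSupport (hb : IsAmplitude m b S) (ξ : Eucl n) :
    HasCompactSupport fun z => b z ξ :=
  HasCompactSupport.intro hb.isCompact fun z hz => hb.eq_zero z hz ξ

theorem IsAmplitude.integrable (hb : IsAmplitude m b S) (ξ : Eucl n) :
    Integrable fun z => b z ξ :=
  (hb.contDiff_fst ξ).continuous.integrable_of_hasCompactSupport (hb.hasCompactSupport ξ)

theorem IsAmplitude.continuous_ampFourier (hb : IsAmplitude m b S) :
    Continuous fun v : Eucl n × (Eucl n × Eucl n) => ampFourier b v.1 v.2 := by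
  have h : (fun v : Eucl n × (Eucl n × Eucl n) => ampFourier b v.1 v.2)
      = fun v => ∫ z in S, Real.fourierChar (-(pairForm n z v.2)) • b z v.1 := by
    ext1 v
    rw [ampFourier_eq, setIntegral_eq_integral_of_forall_compl_eq_zero]
    intro z hz
    rw [hb.eq_zero z hz, smul_zero]
  rw [h]
  refine continuous_parametric_integral_of_continuous ?_ hb.isCompact
  have hc := hb.continuous
  have h1 : Continuous fun v : (Eucl n × (Eucl n × Eucl n)) × (Eucl n × Eucl n) =>
      b v.2 v.1.1 := hc.comp (continuous_snd.prodMk (continuous_fst.comp continuous_fst))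
  have h2 : Continuous fun v : (Eucl n × (Eucl n × Eucl n)) × (Eucl n × Eucl n) =>
      Real.fourierChar (-(pairForm n v.2 v.1.2)) := by
    refine Real.continuous_fourierChar.comp ?_
    fun_prop
  exact h2.smul h1

theorem IsAmplitude.integral_norm_iteratedFDeriv_le (hb : IsAmplitude m b S) (i : ℕ) :
    ∃ A : ℝ, 0 ≤ A ∧ ∀ ξ, ∫ z, ‖iteratedFDeriv ℝ i (fun z => b z ξ) z‖
      ≤ A * bracketSq ξ ^ (m / 2) := by
  obtain ⟨A, hA⟩ := hb.bound i
  refine ⟨|A| * volume.real S, by positivity, fun ξ => ?_⟩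
  have hzero : ∀ z, z ∉ S → ‖iteratedFDeriv ℝ i (fun z => b z ξ) z‖ = 0 := by
    intro z hz
    rw [norm_eq_zero]
    by_contra hne
    refine hz (closure_minimal ?_ hb.isCompact.isClosed
      (support_iteratedFDeriv_subset (𝕜 := ℝ) (f := fun z => b z ξ) i hne))
    intro y hy
    by_contra hy'
    exact hy (hb.eq_zero y hy' ξ)
  rw [← setIntegral_eq_integral_of_forall_compl_eq_zero hzero]
  refine (Real.le_norm_self _).trans ((norm_setIntegral_le_of_norm_le_const
    (C := |A| * bracketSq ξ ^ (m / 2)) hb.isCompact.measure_lt_top fun z _ => ?_).trans (le_of_eq ?_))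
  · rw [norm_norm]
    refine (hA z ξ).trans ?_
    gcongr
    · exact (bracketSq_rpow_pos ξ _).le
    · exact le_abs_self A
  · ring

/-- The partial Fourier transform of a compactly supported amplitude decreases rapidly. -/
theorem IsAmplitude.exists_norm_pow_mul_le (hb : IsAmplitude m b S) (k : ℕ) :
    ∃ A : ℝ, 0 ≤ A ∧ ∀ ξ w, ‖w‖ ^ k * ‖ampFourier b ξ w‖ ≤ A * bracketSq ξ ^ (m / 2) := by
  choose A hA0 hA using hb.integral_norm_iteratedFDeriv_le
  refine ⟨2 ^ k * ∑ i ∈ Finset.range (k + 1), A i,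
    mul_nonneg (by positivity) (Finset.sum_nonneg fun i _ => hA0 i), fun ξ w => ?_⟩
  have hint : ∀ i : ℕ, Integrable fun z => ‖iteratedFDeriv ℝ i (fun z => b z ξ) z‖ := fun i =>
    (((hb.contDiff_fst ξ).continuous_iteratedFDeriv
      (by exact_mod_cast le_top)).integrable_of_hasCompactSupport
        ((hb.hasCompactSupport ξ).iteratedFDeriv i)).norm
  have hmain : ∀ v : Eucl n × Eucl n, |pairForm n v w| ^ k * ‖ampFourier b ξ w‖
      ≤ ‖v‖ ^ k * (2 ^ k * ((∑ i ∈ Finset.range (k + 1), A i) * bracketSq ξ ^ (m / 2))) := by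
    intro v
    have h := VectorFourier.pow_mul_norm_iteratedFDeriv_fourierIntegral_le (pairForm n)
      (μ := volume) (K := 0) (N := ⊤) (f := fun z => b z ξ) (hb.contDiff_fst ξ)
      (fun i j hi _ => by
        have : i = 0 := by simpa using hi
        subst this
        simpa using hint j) (k := 0) (n := k) (by simp) (by simp) v w
    rw [norm_iteratedFDeriv_zero] at h
    refine h.trans ?_
    rw [pow_zero, mul_one, mul_assoc, zero_add, Finset.range_one, Finset.sum_product,
      Finset.sum_singleton, Nat.cast_zero, mul_zero, zero_add]
    gcongr
    rw [Finset.sum_mul]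
    refine Finset.sum_le_sum fun i _ => ?_
    simpa using hA i ξ
  rcases eq_or_ne k 0 with rfl | hk
  · simpa using hmain 0
  rcases eq_or_ne w 0 with rfl | hw
  · rw [norm_zero, zero_pow hk, zero_mul]
    exact mul_nonneg (mul_nonneg (by positivity) (Finset.sum_nonneg fun i _ => hA0 i))
      (bracketSq_rpow_pos ξ _).le
  have hpos : 0 < ‖w‖ ^ k := by positivity
  refine le_of_mul_le_mul_left ?_ hpos
  -- In this direction the form equals `|w.1|² + |w.2|²`, at least the square of the maximum norm of
  -- `w`, so one factor `‖w‖ ^ k` can be cancelled.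
  have h := hmain (w.1, -w.2)
  have hn : ‖((w.1, -w.2) : Eucl n × Eucl n)‖ = ‖w‖ := by simp [Prod.norm_def]
  rw [hn] at h
  refine le_trans ?_ (h.trans (le_of_eq (by ring)))
  rw [← mul_assoc, ← pow_add, ← two_mul, pow_mul]
  gcongr
  rw [pairForm_apply, inner_neg_left, sub_neg_eq_add, real_inner_self_eq_norm_sq,
    real_inner_self_eq_norm_sq, abs_of_nonneg (by positivity), Prod.norm_def]
  rcases max_choice ‖w.1‖ ‖w.2‖ with h | h <;> rw [h] <;> nlinarith [sq_nonneg ‖w.1‖, sq_nonneg ‖w.2‖]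

/-- The powers `0` and `4N` of `‖w‖` suffice: both brackets are at most `1 + ‖(p,q)‖²`, and `(1 +
t)^{2N} ≤ 2^{2N} (1 + t^{2N})`. -/
theorem IsAmplitude.exists_norm_mul_bracketSq_le (hb : IsAmplitude m b S) (N : ℕ) :
    ∃ A : ℝ, 0 ≤ A ∧ ∀ ξ p q, ‖ampFourier b ξ (p, q)‖ * (bracketSq p ^ N * bracketSq q ^ N)
      ≤ A * bracketSq ξ ^ (m / 2) := by
  obtain ⟨A0, hA0, h0⟩ := hb.exists_norm_pow_mul_le 0
  obtain ⟨A1, hA1, h1⟩ := hb.exists_norm_pow_mul_le (2 * (2 * N))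
  refine ⟨2 ^ (2 * N) * (A0 + A1), by positivity, fun ξ p q => ?_⟩
  have e0 := h0 ξ (p, q)
  have e1 := h1 ξ (p, q)
  rw [pow_zero, one_mul] at e0
  have hle : bracketSq p ^ N * bracketSq q ^ N
      ≤ 2 ^ (2 * N) * (1 + ‖((p, q) : Eucl n × Eucl n)‖ ^ (2 * (2 * N))) := by
    have hp : bracketSq p ≤ 1 + ‖((p, q) : Eucl n × Eucl n)‖ ^ 2 := by
      unfold bracketSq
      have := norm_fst_le ((p, q) : Eucl n × Eucl n)
      gcongr
    have hq : bracketSq q ≤ 1 + ‖((p, q) : Eucl n × Eucl n)‖ ^ 2 := by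
      unfold bracketSq
      have := norm_snd_le ((p, q) : Eucl n × Eucl n)
      gcongr
    have hp0 := bracketSq_pos p
    have hq0 := bracketSq_pos q
    calc bracketSq p ^ N * bracketSq q ^ N
        ≤ (1 + ‖((p, q) : Eucl n × Eucl n)‖ ^ 2) ^ N * (1 + ‖((p, q) : Eucl n × Eucl n)‖ ^ 2) ^ N := by
          gcongr
      _ = (1 + ‖((p, q) : Eucl n × Eucl n)‖ ^ 2) ^ (2 * N) := by ring
      _ ≤ 2 ^ (2 * N) * (1 ^ (2 * N) + (‖((p, q) : Eucl n × Eucl n)‖ ^ 2) ^ (2 * N)) := by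
          refine (add_pow_le zero_le_one (by positivity) _).trans ?_
          gcongr
          · norm_num
          · omega
      _ = _ := by rw [one_pow, ← pow_mul]
  calc ‖ampFourier b ξ (p, q)‖ * (bracketSq p ^ N * bracketSq q ^ N)
      ≤ ‖ampFourier b ξ (p, q)‖
        * (2 ^ (2 * N) * (1 + ‖((p, q) : Eucl n × Eucl n)‖ ^ (2 * (2 * N)))) := by gcongr
    _ = 2 ^ (2 * N) * (‖ampFourier b ξ (p, q)‖
        + ‖((p, q) : Eucl n × Eucl n)‖ ^ (2 * (2 * N)) * ‖ampFourier b ξ (p, q)‖) := by ring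
    _ ≤ 2 ^ (2 * N) * (A0 * bracketSq ξ ^ (m / 2) + A1 * bracketSq ξ ^ (m / 2)) := by gcongr
    _ = _ := by ring

/-- The matrix elements of the oscillatory integral operator at frequency `ξ` between the
exponentials with frequencies `η` and `ζ`. -/
def freqAmp (b : Eucl n × Eucl n → Eucl n → ℂ) (ξ η ζ : Eucl n) : ℂ :=
  ampFourier b ξ (η - (2 * Real.pi)⁻¹ • ξ, ζ - (2 * Real.pi)⁻¹ • ξ)

/-- The central estimate. Peetre's inequality moves both weights to the common point `t = ξ/2π`,
where the exponents `m/2`, `(s-m)/2` and `-s/2` add up to zero. The losses are powers of the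
brackets of `p = η - t` and `q = ζ - t`, controlled by rapid decay. The remaining decay gives one
factor integrable in `ξ` and, because `η - ζ = p - q`, one factor of convolution type. -/
theorem IsAmplitude.exists_norm_freqAmp_le (hb : IsAmplitude m b S) (s : ℝ) :
    ∃ A : ℝ, 0 ≤ A ∧ ∀ ξ η ζ : Eucl n,
      ‖freqAmp b ξ η ζ‖ * (bracketSq η ^ ((s - m) / 2) * bracketSq ζ ^ (-s / 2))
        ≤ A * (decay (η - (2 * Real.pi)⁻¹ • ξ) * decay (η - ζ)) := by
  set r₁ : ℝ := (s - m) / 2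
  set r₂ : ℝ := -s / 2
  set d : ℝ := ((n : ℝ) + 1) / 2 with hd
  have hd0 : 0 ≤ d := by positivity
  -- `|r₁|` and `|r₂|` pay for Peetre's inequality; of the two `d`, one yields `decay p`, the other
  -- `decay (η - ζ)`.
  obtain ⟨N, hN⟩ := exists_nat_ge (|r₁| + |r₂| + 2 * d)
  obtain ⟨A, hA0, hA⟩ := hb.exists_norm_mul_bracketSq_le N
  set c : ℝ := ((2 * Real.pi) ^ 2) ^ |m / 2|
  refine ⟨2 ^ |r₁| * 2 ^ |r₂| * A * c * 2 ^ d, by positivity, fun ξ η ζ => ?_⟩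
  set t := (2 * Real.pi)⁻¹ • ξ with ht
  set p := η - t with hp
  set q := ζ - t with hq
  have h1 : bracketSq η ^ r₁ ≤ 2 ^ |r₁| * bracketSq p ^ |r₁| * bracketSq t ^ r₁ :=
    bracketSq_rpow_le η t r₁
  have h2 : bracketSq ζ ^ r₂ ≤ 2 ^ |r₂| * bracketSq q ^ |r₂| * bracketSq t ^ r₂ :=
    bracketSq_rpow_le ζ t r₂
  have h3 : bracketSq ξ ^ (m / 2) ≤ c * bracketSq t ^ (m / 2) :=
    bracketSq_rpow_two_pi_smul_le ξ (m / 2)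
  have h4 : bracketSq p ^ |r₁| ≤ bracketSq p ^ N * (decay p * bracketSq p ^ (-d)) := by
    rw [decay, ← Real.rpow_natCast, ← Real.rpow_add (bracketSq_pos p),
      ← Real.rpow_add (bracketSq_pos p)]
    refine Real.rpow_le_rpow_of_exponent_le (one_le_bracketSq p) ?_
    have := abs_nonneg r₂
    rw [neg_div, ← hd]
    linarith
  have h5 : bracketSq q ^ |r₂| ≤ bracketSq q ^ N * bracketSq q ^ (-d) := by
    rw [← Real.rpow_natCast, ← Real.rpow_add (bracketSq_pos q)]
    refine Real.rpow_le_rpow_of_exponent_le (one_le_bracketSq q) ?_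
    have := abs_nonneg r₁
    linarith
  have h6 : bracketSq p ^ (-d) * bracketSq q ^ (-d) ≤ 2 ^ d * decay (η - ζ) := by
    have e1 : bracketSq (η - ζ) ≤ 2 * bracketSq p * bracketSq q := by
      have := bracketSq_add_le p (-q)
      rw [bracketSq_neg] at this
      rwa [show p + -q = η - ζ by rw [hp, hq]; abel] at this
    have hpq : 0 < bracketSq p * bracketSq q := mul_pos (bracketSq_pos p) (bracketSq_pos q)
    rw [← Real.mul_rpow (bracketSq_pos p).le (bracketSq_pos q).le, decay, neg_div, ← hd]
    have e2 : bracketSq (η - ζ) * 2⁻¹ ≤ bracketSq p * bracketSq q := by linarith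
    have := Real.rpow_le_rpow_of_nonpos (mul_pos (bracketSq_pos (η - ζ)) (by norm_num)) e2
      (neg_nonpos.2 hd0)
    rw [Real.mul_rpow (bracketSq_pos (η - ζ)).le (by norm_num : (0 : ℝ) ≤ 2⁻¹),
      Real.inv_rpow (by norm_num : (0 : ℝ) ≤ 2), Real.rpow_neg (by norm_num : (0 : ℝ) ≤ 2),
      inv_inv] at this
    linarith
  have h7 : bracketSq t ^ (m / 2) * (bracketSq t ^ r₁ * bracketSq t ^ r₂) = 1 := by
    rw [← Real.rpow_add (bracketSq_pos t), ← Real.rpow_add (bracketSq_pos t)]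
    convert Real.rpow_zero _ using 2
    ring
  have hp0 := bracketSq_pos p
  have hq0 := bracketSq_pos q
  have ht0 := bracketSq_pos t
  have hη0 := bracketSq_pos η
  have hζ0 := bracketSq_pos ζ
  have hdp := decay_pos p
  calc ‖freqAmp b ξ η ζ‖ * (bracketSq η ^ r₁ * bracketSq ζ ^ r₂)
      ≤ ‖freqAmp b ξ η ζ‖ * ((2 ^ |r₁| * (bracketSq p ^ N * (decay p * bracketSq p ^ (-d)))
          * bracketSq t ^ r₁) * (2 ^ |r₂| * (bracketSq q ^ N * bracketSq q ^ (-d))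
          * bracketSq t ^ r₂)) := by
        gcongr
        · exact h1.trans (by gcongr)
        · exact h2.trans (by gcongr)
    _ = (‖ampFourier b ξ (p, q)‖ * (bracketSq p ^ N * bracketSq q ^ N))
          * (2 ^ |r₁| * 2 ^ |r₂| * (bracketSq t ^ r₁ * bracketSq t ^ r₂) * decay p
          * (bracketSq p ^ (-d) * bracketSq q ^ (-d))) := by
        rw [freqAmp]; ring
    _ ≤ (A * (c * bracketSq t ^ (m / 2)))
          * (2 ^ |r₁| * 2 ^ |r₂| * (bracketSq t ^ r₁ * bracketSq t ^ r₂) * decay p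
          * (2 ^ d * decay (η - ζ))) := by
        refine mul_le_mul ((hA ξ p q).trans (by gcongr)) (by gcongr) (by positivity) (by positivity)
    _ = 2 ^ |r₁| * 2 ^ |r₂| * A * c * 2 ^ d * (decay p * decay (η - ζ))
          * (bracketSq t ^ (m / 2) * (bracketSq t ^ r₁ * bracketSq t ^ r₂)) := by ring
    _ = _ := by rw [h7, mul_one]

end

/-! ### The kernel in the frequency variables -/

section

variable {n : ℕ} {m : ℝ} {b : Eucl n × Eucl n → Eucl n → ℂ} {S : Set (Eucl n × Eucl n)}

theorem integrable_decay_sub_smul (η : Eucl n) :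
    Integrable fun ξ : Eucl n => decay (η - (2 * Real.pi)⁻¹ • ξ) := by
  have h : Integrable fun ξ : Eucl n => decay ((2 * Real.pi)⁻¹ • ξ) :=
    integrable_decay.comp_smul (by positivity)
  have h2 := h.comp_sub_left ((2 * Real.pi) • η)
  refine h2.congr (Eventually.of_forall fun ξ => ?_)
  simp only [smul_sub]
  rw [inv_smul_smul₀ (by positivity)]

theorem integral_decay_sub_smul (η : Eucl n) :
    ∫ ξ : Eucl n, decay (η - (2 * Real.pi)⁻¹ • ξ) = ∫ ξ : Eucl n, decay ((2 * Real.pi)⁻¹ • ξ) := by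
  rw [← integral_sub_left_eq_self (fun ξ : Eucl n => decay ((2 * Real.pi)⁻¹ • ξ)) volume
    ((2 * Real.pi) • η)]
  refine integral_congr_ae (Eventually.of_forall fun ξ => ?_)
  simp only [smul_sub]
  rw [inv_smul_smul₀ (by positivity)]

theorem IsAmplitude.continuous_freqAmp (hb : IsAmplitude m b S) :
    Continuous fun v : Eucl n × (Eucl n × Eucl n) => freqAmp b v.1 v.2.1 v.2.2 := by
  have h : Continuous fun v : Eucl n × (Eucl n × Eucl n) =>
      ((v.1, (v.2.1 - (2 * Real.pi)⁻¹ • v.1, v.2.2 - (2 * Real.pi)⁻¹ • v.1)) :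
        Eucl n × (Eucl n × Eucl n)) := by fun_prop
  have h0 := hb.continuous_ampFourier
  have h1 := h0.comp' h
  exact h1

/-- The case `s = 0` with the decay in `η - ζ` discarded: a majorant integrable in `ξ` and of
polynomial size in `η`, suited to Fubini against Schwartz functions. -/
theorem IsAmplitude.exists_norm_freqAmp_le' (hb : IsAmplitude m b S) :
    ∃ A : ℝ, 0 ≤ A ∧ ∀ ξ η ζ : Eucl n,
      ‖freqAmp b ξ η ζ‖ ≤ A * (decay (η - (2 * Real.pi)⁻¹ • ξ) * bracketSq η ^ (m / 2)) := by
  obtain ⟨A, hA0, hA⟩ := hb.exists_norm_freqAmp_le 0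
  refine ⟨A, hA0, fun ξ η ζ => ?_⟩
  have h := hA ξ η ζ
  rw [neg_zero, zero_div, Real.rpow_zero, mul_one, zero_sub, neg_div,
    Real.rpow_neg (bracketSq_pos η).le, ← div_eq_mul_inv,
    div_le_iff₀ (bracketSq_rpow_pos η _)] at h
  refine h.trans ?_
  have h1 := decay_pos (η - (2 * Real.pi)⁻¹ • ξ)
  have h2 := decay_le_one (η - ζ)
  have h3 := bracketSq_rpow_pos η (m / 2)
  have h4 := mul_le_of_le_one_right h1.le h2
  rw [mul_assoc]
  gcongr

/-- The integral kernel of the oscillatory integral operator in the frequency variables. -/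
def freqKernel (b : Eucl n × Eucl n → Eucl n → ℂ) (η ζ : Eucl n) : ℂ := ∫ ξ, freqAmp b ξ η ζ

theorem IsAmplitude.stronglyMeasurable_freqKernel (hb : IsAmplitude m b S) :
    StronglyMeasurable fun z : Eucl n × Eucl n => freqKernel b z.1 z.2 := by
  have h0 := hb.continuous_freqAmp
  have h1 : Continuous fun p : (Eucl n × Eucl n) × Eucl n => (p.2, p.1) := by fun_prop
  have h := h0.comp' h1
  exact h.stronglyMeasurable.integral_prod_right'

/-- The `ξ`-integral of the first decay factor does not depend on `η`, so only the convolution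
factor survives. -/
theorem IsAmplitude.exists_norm_freqKernel_le (hb : IsAmplitude m b S) (s : ℝ) :
    ∃ A : ℝ, 0 ≤ A ∧ ∀ η ζ : Eucl n,
      ‖freqKernel b η ζ‖ * (bracketSq η ^ ((s - m) / 2) * bracketSq ζ ^ (-s / 2))
        ≤ A * decay (η - ζ) := by
  obtain ⟨A, hA0, hA⟩ := hb.exists_norm_freqAmp_le s
  refine ⟨A * ∫ ξ : Eucl n, decay ((2 * Real.pi)⁻¹ • ξ),
    mul_nonneg hA0 (integral_nonneg fun ξ => (decay_pos _).le), fun η ζ => ?_⟩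
  have hw : 0 < bracketSq η ^ ((s - m) / 2) * bracketSq ζ ^ (-s / 2) :=
    mul_pos (bracketSq_rpow_pos η _) (bracketSq_rpow_pos ζ _)
  rw [← le_div_iff₀ hw]
  have h : ‖freqKernel b η ζ‖ ≤ ∫ ξ : Eucl n, decay (η - (2 * Real.pi)⁻¹ • ξ)
      * (A * decay (η - ζ) / (bracketSq η ^ ((s - m) / 2) * bracketSq ζ ^ (-s / 2))) := by
    refine norm_integral_le_of_norm_le ((integrable_decay_sub_smul η).mul_const _)
      (Eventually.of_forall fun ξ => ?_)
    rw [← mul_div_assoc, le_div_iff₀ hw]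
    exact (hA ξ η ζ).trans (le_of_eq (by ring))
  refine h.trans (le_of_eq ?_)
  rw [integral_mul_const, integral_decay_sub_smul]
  ring

/-! ### Parseval's identity for the oscillatory integral -/

theorem integrable_prod_schwartz (f g : 𝓢(Eucl n, ℂ)) :
    Integrable fun w : Eucl n × Eucl n => f w.1 * g w.2 :=
  f.integrable.mul_prod g.integrable

/-- Fourier inversion in each variable. The opposite signs in `pairForm` are the reason for pairing
`𝓕⁻ φ` with `𝓕 ψ`. -/
theorem fourierIntegral_flip_pairForm (φ ψ : 𝓢(Eucl n, ℂ)) (z : Eucl n × Eucl n) :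
    VectorFourier.fourierIntegral Real.fourierChar volume
      (ContinuousLinearMap.toLinearMap₁₂ (pairForm n)).flip
      (fun w : Eucl n × Eucl n => (𝓕⁻ φ) w.1 * (𝓕 ψ) w.2) z = φ z.1 * ψ z.2 := by
  have h1 : φ z.1 = ∫ v : Eucl n, Real.fourierChar (-(inner ℝ v z.1)) • (𝓕⁻ φ) v := by
    conv_lhs => rw [← FourierTransform.fourier_fourierInv_eq (F := 𝓢(Eucl n, ℂ)) φ]
    rw [SchwartzMap.fourier_coe, Real.fourier_eq]
  have h2 : ψ z.2 = ∫ v : Eucl n, Real.fourierChar (inner ℝ v z.2) • (𝓕 ψ) v := by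
    conv_lhs => rw [← FourierTransform.fourierInv_fourier_eq (F := 𝓢(Eucl n, ℂ)) ψ]
    rw [SchwartzMap.fourierInv_coe, Real.fourierInv_eq]
  rw [h1, h2, ← integral_prod_mul]
  refine integral_congr_ae (Eventually.of_forall fun w => ?_)
  change Real.fourierChar (-(pairForm n z w)) • ((𝓕⁻ φ) w.1 * (𝓕 ψ) w.2) = _
  rw [pairForm_apply, neg_sub, sub_eq_neg_add, AddChar.map_add_eq_mul, real_inner_comm w.1,
    real_inner_comm w.2]
  simp only [Circle.smul_def, Circle.coe_mul, smul_eq_mul]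
  ring

/-- Modulation by the phase is a translation of both frequencies, which explains the arguments in
`freqAmp`. -/
theorem fourierChar_neg_pairForm_sub (z w : Eucl n × Eucl n) (ξ : Eucl n) :
    (Real.fourierChar (-(pairForm n z
        (w.1 - (2 * Real.pi)⁻¹ • ξ, w.2 - (2 * Real.pi)⁻¹ • ξ))) : ℂ)
      = Real.fourierChar (-(pairForm n z w))
        * Complex.exp (Complex.I * (inner ℝ (z.1 - z.2) ξ : ℝ)) := by
  rw [Real.fourierChar_apply, Real.fourierChar_apply, ← Complex.exp_add]
  congr 1
  simp only [pairForm_apply, inner_sub_left, inner_sub_right, inner_smul_right]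
  push_cast
  have : (Real.pi : ℂ) ≠ 0 := by exact_mod_cast Real.pi_ne_zero
  field_simp
  ring

/-- The oscillatory integral at frequency `ξ`, paired with a tensor product of Schwartz
functions. -/
theorem IsAmplitude.integral_exp_mul_eq (hb : IsAmplitude m b S) (φ ψ : 𝓢(Eucl n, ℂ))
    (ξ : Eucl n) :
    ∫ z : Eucl n × Eucl n, Complex.exp (Complex.I * (inner ℝ (z.1 - z.2) ξ : ℝ)) * b z ξ
        * (φ z.1 * ψ z.2)
      = ∫ w : Eucl n × Eucl n, freqAmp b ξ w.1 w.2 * ((𝓕⁻ φ) w.1 * (𝓕 ψ) w.2) := by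
  have hf : Integrable fun z : Eucl n × Eucl n =>
      Complex.exp (Complex.I * (inner ℝ (z.1 - z.2) ξ : ℝ)) * b z ξ := by
    refine Continuous.integrable_of_hasCompactSupport ?_ (hb.hasCompactSupport ξ).mul_left
    have := (hb.contDiff_fst ξ).continuous
    fun_prop
  have h := VectorFourier.integral_fourierIntegral_smul_eq_flip
    (L := ContinuousLinearMap.toLinearMap₁₂ (pairForm n)) (μ := volume) (ν := volume)
    Real.continuous_fourierChar
    (show Continuous fun p : (Eucl n × Eucl n) × (Eucl n × Eucl n) => pairForm n p.1 p.2 by fun_prop)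
    hf (integrable_prod_schwartz (𝓕⁻ φ) (𝓕 ψ))
  simp only [fourierIntegral_flip_pairForm, smul_eq_mul] at h
  rw [← h]
  refine integral_congr_ae (Eventually.of_forall fun w => ?_)
  simp only
  congr 1
  rw [freqAmp, ampFourier_eq]
  refine integral_congr_ae (Eventually.of_forall fun z => ?_)
  simp only [Circle.smul_def, smul_eq_mul]
  rw [fourierChar_neg_pairForm_sub, mul_assoc]
  rfl

theorem IsAmplitude.integrable_freqAmp_mul (hb : IsAmplitude m b S) (f g : 𝓢(Eucl n, ℂ)) :
    Integrable fun v : Eucl n × (Eucl n × Eucl n) =>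
      freqAmp b v.1 v.2.1 v.2.2 * (f v.2.1 * g v.2.2) := by
  obtain ⟨A, hA0, hA⟩ := hb.exists_norm_freqAmp_le'
  have hdc := continuous_decay (n := n)
  have hbc := continuous_bracketSq_rpow (n := n) (m / 2)
  have hwt : Function.HasTemperateGrowth fun x : Eucl n => ((bracketSq x ^ (m / 2) : ℝ) : ℂ) := by
    unfold bracketSq; fun_prop
  have hF : Integrable fun w : Eucl n × Eucl n =>
      ‖((bracketSq w.1 ^ (m / 2) : ℝ) : ℂ) * f w.1 * g w.2‖ := by
    have := (integrable_prod_schwartz (SchwartzMap.smulLeftCLM ℂ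
      (fun x : Eucl n => ((bracketSq x ^ (m / 2) : ℝ) : ℂ)) f) g).norm
    refine this.congr (Eventually.of_forall fun w => ?_)
    simp only [SchwartzMap.smulLeftCLM_apply_apply hwt, smul_eq_mul]
  have hG : Integrable fun v : Eucl n × (Eucl n × Eucl n) =>
      A * (decay (v.2.1 - (2 * Real.pi)⁻¹ • v.1)
        * ‖((bracketSq v.2.1 ^ (m / 2) : ℝ) : ℂ) * f v.2.1 * g v.2.2‖) := by
    refine Integrable.const_mul ?_ A
    rw [Measure.volume_eq_prod, integrable_prod_iff' (by
      refine Continuous.aestronglyMeasurable ?_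
      have h1 := f.continuous
      have h2 := g.continuous
      have h3 : Continuous fun v : Eucl n × (Eucl n × Eucl n) => bracketSq v.2.1 ^ (m / 2) :=
        hbc.comp (continuous_fst.comp continuous_snd)
      exact Continuous.mul (by fun_prop) (((Complex.continuous_ofReal.comp h3).mul
        (by fun_prop)).mul (by fun_prop)).norm)]
    refine ⟨Eventually.of_forall fun w => ?_, ?_⟩
    · exact (integrable_decay_sub_smul w.1).mul_const
        ‖((bracketSq w.1 ^ (m / 2) : ℝ) : ℂ) * f w.1 * g w.2‖
    · refine (hF.const_mul (∫ ξ : Eucl n, decay ((2 * Real.pi)⁻¹ • ξ))).congr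
        (Eventually.of_forall fun w => ?_)
      simp only [norm_mul, norm_norm]
      rw [integral_mul_const]
      congr 1
      rw [← integral_decay_sub_smul w.1]
      refine integral_congr_ae (Eventually.of_forall fun ξ => ?_)
      simp only [Real.norm_of_nonneg (decay_pos _).le]
  refine hG.mono' ?_ (Eventually.of_forall fun v => ?_)
  · refine Continuous.aestronglyMeasurable ?_
    have := f.continuous
    have := g.continuous
    exact hb.continuous_freqAmp.mul (by fun_prop)
  · rw [norm_mul]
    refine (mul_le_mul_of_nonneg_right (hA v.1 v.2.1 v.2.2) (norm_nonneg _)).trans (le_of_eq ?_)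
    rw [norm_mul, norm_mul, norm_mul, Complex.norm_real,
      Real.norm_of_nonneg (bracketSq_rpow_pos _ _).le]
    ring

/-- Integrating over space first creates enough decay in `ξ` for absolute convergence, whatever the
order `m`. -/
theorem IsAmplitude.integrable_integral_exp_mul (hb : IsAmplitude m b S) (φ ψ : 𝓢(Eucl n, ℂ)) :
    Integrable fun ξ : Eucl n => ∫ z : Eucl n × Eucl n,
      Complex.exp (Complex.I * (inner ℝ (z.1 - z.2) ξ : ℝ)) * b z ξ * (φ z.1 * ψ z.2) := by
  simp only [hb.integral_exp_mul_eq]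
  exact (hb.integrable_freqAmp_mul (𝓕⁻ φ) (𝓕 ψ)).integral_prod_left

theorem IsAmplitude.integral_integral_exp_mul (hb : IsAmplitude m b S) (φ ψ : 𝓢(Eucl n, ℂ)) :
    ∫ ξ : Eucl n, ∫ z : Eucl n × Eucl n,
        Complex.exp (Complex.I * (inner ℝ (z.1 - z.2) ξ : ℝ)) * b z ξ * (φ z.1 * ψ z.2)
      = ∫ w : Eucl n × Eucl n, freqKernel b w.1 w.2 * ((𝓕⁻ φ) w.1 * (𝓕 ψ) w.2) := by
  simp only [hb.integral_exp_mul_eq]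
  rw [integral_integral_swap (hb.integrable_freqAmp_mul (𝓕⁻ φ) (𝓕 ψ))]
  refine integral_congr_ae (Eventually.of_forall fun w => ?_)
  simp only [freqKernel]
  rw [integral_mul_const]

end

/-! ### The regularized oscillatory integral -/

theorem exists_isCutoff (n : ℕ) : ∃ χ : Eucl n → ℝ, IsCutoff χ := by
  let f : ContDiffBump (0 : Eucl n) := ⟨1, 2, one_pos, one_lt_two⟩
  exact ⟨f, f.contDiff, f.hasCompactSupport, f.eventuallyEq_one⟩

section

variable {n : ℕ} {m : ℝ} {b : Eucl n × Eucl n → Eucl n → ℂ} {S : Set (Eucl n × Eucl n)}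

theorem IsAmplitude.integrable_cutoff_mul (hb : IsAmplitude m b S) (φ ψ : 𝓢(Eucl n, ℂ))
    {χ : Eucl n → ℝ} (hχ : IsCutoff χ) {ε : ℝ} (hε : ε ≠ 0) :
    Integrable fun w : (Eucl n × Eucl n) × Eucl n => (χ (ε • w.2) : ℂ) *
      (Complex.exp (Complex.I * (inner ℝ (w.1.1 - w.1.2) w.2 : ℝ)) * b w.1 w.2
        * (φ w.1.1 * ψ w.1.2)) := by
  refine Continuous.integrable_of_hasCompactSupport ?_ ?_
  · have h1 := hb.continuous
    have h2 := hχ.1.continuous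
    have h3 := φ.continuous
    have h4 := ψ.continuous
    fun_prop
  · have hcs : HasCompactSupport fun ξ : Eucl n => χ (ε • ξ) := hχ.2.1.comp_smul hε
    refine HasCompactSupport.intro (hb.isCompact.prod hcs) fun w hw => ?_
    by_cases h1 : w.1 ∈ S
    · have h2 : w.2 ∉ tsupport fun ξ : Eucl n => χ (ε • ξ) := fun h => hw ⟨h1, h⟩
      have h3 := image_eq_zero_of_notMem_tsupport h2
      rw [h3, Complex.ofReal_zero, zero_mul]
    · rw [hb.eq_zero _ h1, mul_zero, zero_mul, mul_zero]

/-- The value of an oscillatory integral as an iterated integral. -/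
theorem IsAmplitude.eq_of_hasOscPairing (hb : IsAmplitude m b S)
    {a : Eucl n × Eucl n → Eucl n → ℂ} {Ψ : Test2 n} {c : ℂ} (h : HasOscPairing a Ψ c)
    (φ ψ : 𝓢(Eucl n, ℂ)) (hab : ∀ z ξ, a z ξ * Ψ z = b z ξ * (φ z.1 * ψ z.2)) :
    c = ∫ w : Eucl n × Eucl n, freqKernel b w.1 w.2 * ((𝓕⁻ φ) w.1 * (𝓕 ψ) w.2) := by
  rw [← hb.integral_integral_exp_mul]
  obtain ⟨χ, hχ⟩ := exists_isCutoff n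
  refine tendsto_nhds_unique (h χ hχ) ?_
  set F : Eucl n → ℂ := fun ξ => ∫ z : Eucl n × Eucl n,
      Complex.exp (Complex.I * (inner ℝ (z.1 - z.2) ξ : ℝ)) * b z ξ * (φ z.1 * ψ z.2) with hF
  have hFi : Integrable F := hb.integrable_integral_exp_mul φ ψ
  have hreg : ∀ᶠ ε in 𝓝[>] (0 : ℝ),
      ∫ ξ, (χ (ε • ξ) : ℂ) * F ξ = regularizedPairing a χ Ψ ε := by
    filter_upwards [self_mem_nhdsWithin] with ε hε
    have hi := hb.integrable_cutoff_mul φ ψ hχ (ne_of_gt hε)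
    rw [Measure.volume_eq_prod] at hi
    have h1 := integral_prod_symm _ hi
    rw [← Measure.volume_eq_prod] at h1
    rw [regularizedPairing]
    calc ∫ ξ, (χ (ε • ξ) : ℂ) * F ξ
        = ∫ ξ, ∫ z : Eucl n × Eucl n, (χ (ε • ξ) : ℂ) *
          (Complex.exp (Complex.I * (inner ℝ (z.1 - z.2) ξ : ℝ)) * b z ξ * (φ z.1 * ψ z.2)) := by
          refine integral_congr_ae (Eventually.of_forall fun ξ => ?_)
          simp only [hF]
          rw [integral_const_mul]
      _ = _ := h1.symm
      _ = _ := by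
          refine integral_congr_ae (Eventually.of_forall fun w => ?_)
          simp only
          rw [mul_assoc _ (b _ _), ← hab]
          ring
  -- Dominated convergence: `χ (ε • ξ)` is bounded and, for each fixed `ξ`, equals `1` once `ε` is
  -- small.
  refine Tendsto.congr' hreg ?_
  obtain ⟨C, hC⟩ := hχ.1.continuous.bounded_above_of_compact_support hχ.2.1
  refine tendsto_integral_filter_of_dominated_convergence (fun ξ => C * ‖F ξ‖) ?_ ?_ ?_ ?_
  · refine Eventually.of_forall fun ε => AEStronglyMeasurable.mul ?_ hFi.aestronglyMeasurable
    have := hχ.1.continuous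
    exact Continuous.aestronglyMeasurable (by fun_prop)
  · refine Eventually.of_forall fun ε => Eventually.of_forall fun ξ => ?_
    rw [norm_mul, Complex.norm_real]
    gcongr
    exact hC _
  · exact hFi.norm.const_mul C
  · refine Eventually.of_forall fun ξ => ?_
    have h0 : Tendsto (fun ε : ℝ => ε • ξ) (𝓝[>] 0) (𝓝 0) := by
      have : Tendsto (fun ε : ℝ => ε • ξ) (𝓝 0) (𝓝 ((0 : ℝ) • ξ)) :=
        (continuous_id.smul continuous_const).tendsto 0
      rw [zero_smul] at this
      exact this.mono_left nhdsWithin_le_nhds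
    refine tendsto_const_nhds.congr' ?_
    filter_upwards [h0.eventually hχ.2.2] with ε hε
    rw [hε, Complex.ofReal_one, one_mul]

/-! ### Bounds for the bilinear form -/

/-- With the weights absorbed into the kernel, the form is dominated by convolution with `decay`. -/
theorem IsAmplitude.exists_lintegral_freqKernel_le (hb : IsAmplitude m b S) (s : ℝ) :
    ∃ A : ℝ, 0 ≤ A ∧ ∀ F U : Eucl n → ℂ, StronglyMeasurable F → StronglyMeasurable U →
      ∫⁻ w : Eucl n × Eucl n, ‖freqKernel b w.1 w.2 *
        ((((bracketSq w.1 ^ ((s - m) / 2) : ℝ) : ℂ) * F w.1)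
          * (((bracketSq w.2 ^ (-s / 2) : ℝ) : ℂ) * U w.2))‖ₑ
        ≤ ENNReal.ofReal A * (eLpNorm F 2 volume * eLpNorm U 2 volume) := by
  obtain ⟨A, hA0, hA⟩ := hb.exists_norm_freqKernel_le s
  have hfin : ∫⁻ x : Eucl n, ‖decay x‖ₑ = ENNReal.ofReal (∫ x : Eucl n, decay x) := by
    rw [ofReal_integral_eq_lintegral_ofReal integrable_decay
      (Eventually.of_forall fun x => (decay_pos x).le)]
    refine lintegral_congr fun x => ?_
    rw [Real.enorm_eq_ofReal (decay_pos x).le]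
  refine ⟨A * ∫ x : Eucl n, decay x, mul_nonneg hA0 (integral_nonneg fun x => (decay_pos x).le),
    fun F U hF hU => ?_⟩
  calc _ ≤ ∫⁻ w : Eucl n × Eucl n, ENNReal.ofReal A *
          (‖decay (w.1 - w.2)‖ₑ * (‖F w.1‖ₑ * ‖U w.2‖ₑ)) := by
        refine lintegral_mono fun w => ?_
        have h : ‖freqKernel b w.1 w.2 * ((bracketSq w.1 ^ ((s - m) / 2) : ℝ) : ℂ)
            * ((bracketSq w.2 ^ (-s / 2) : ℝ) : ℂ)‖ₑ
            ≤ ENNReal.ofReal A * ‖decay (w.1 - w.2)‖ₑ := by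
          rw [Real.enorm_eq_ofReal (decay_pos _).le, ← ENNReal.ofReal_mul hA0, ← ofReal_norm]
          refine ENNReal.ofReal_le_ofReal ?_
          rw [norm_mul, norm_mul, Complex.norm_real, Complex.norm_real,
            Real.norm_of_nonneg (bracketSq_rpow_pos _ _).le,
            Real.norm_of_nonneg (bracketSq_rpow_pos _ _).le, mul_assoc]
          exact hA w.1 w.2
        calc _ = ‖freqKernel b w.1 w.2 * ((bracketSq w.1 ^ ((s - m) / 2) : ℝ) : ℂ)
            * ((bracketSq w.2 ^ (-s / 2) : ℝ) : ℂ)‖ₑ * (‖F w.1‖ₑ * ‖U w.2‖ₑ) := by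
              rw [← enorm_mul, ← enorm_mul]
              congr 1
              ring
          _ ≤ _ := by
              rw [← mul_assoc (ENNReal.ofReal A)]
              gcongr
    _ = ENNReal.ofReal A * ∫⁻ w : Eucl n × Eucl n,
          (‖decay (w.1 - w.2)‖ₑ * (‖F w.1‖ₑ * ‖U w.2‖ₑ)) := by
        rw [lintegral_const_mul' _ _ ENNReal.ofReal_ne_top]
    _ ≤ ENNReal.ofReal A * ((∫⁻ x : Eucl n, ‖decay x‖ₑ)
          * (eLpNorm F 2 volume * eLpNorm U 2 volume)) := by
        gcongr
        exact lintegral_decay_sub_mul_le hF hU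
    _ = _ := by
        rw [hfin, ← mul_assoc, ← ENNReal.ofReal_mul hA0]

/-- The bilinear form of the operator is bounded on weighted `L²` spaces. -/
theorem IsAmplitude.exists_integrable_freqKernel (hb : IsAmplitude m b S) (s : ℝ) :
    ∃ A : ℝ, 0 ≤ A ∧ ∀ F U : Eucl n → ℂ, StronglyMeasurable F → StronglyMeasurable U →
      MemLp F 2 volume → MemLp U 2 volume →
      Integrable (fun w : Eucl n × Eucl n => freqKernel b w.1 w.2 *
        ((((bracketSq w.1 ^ ((s - m) / 2) : ℝ) : ℂ) * F w.1)
          * (((bracketSq w.2 ^ (-s / 2) : ℝ) : ℂ) * U w.2))) ∧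
      ‖∫ w : Eucl n × Eucl n, freqKernel b w.1 w.2 *
        ((((bracketSq w.1 ^ ((s - m) / 2) : ℝ) : ℂ) * F w.1)
          * (((bracketSq w.2 ^ (-s / 2) : ℝ) : ℂ) * U w.2))‖
        ≤ A * ((eLpNorm F 2 volume).toReal * (eLpNorm U 2 volume).toReal) := by
  obtain ⟨A, hA0, hA⟩ := hb.exists_lintegral_freqKernel_le s
  refine ⟨A, hA0, fun F U hF hU hF2 hU2 => ?_⟩
  have h := hA F U hF hU
  have hlt : ENNReal.ofReal A * (eLpNorm F 2 volume * eLpNorm U 2 volume) < ⊤ :=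
    ENNReal.mul_lt_top ENNReal.ofReal_lt_top (ENNReal.mul_lt_top hF2.2 hU2.2)
  have h1 := (continuous_bracketSq_rpow (n := n) ((s - m) / 2)).stronglyMeasurable
  have h2 := (continuous_bracketSq_rpow (n := n) (-s / 2)).stronglyMeasurable
  have h1' : StronglyMeasurable fun x : Eucl n => ((bracketSq x ^ ((s - m) / 2) : ℝ) : ℂ) :=
    Complex.continuous_ofReal.comp_stronglyMeasurable h1
  have h2' : StronglyMeasurable fun x : Eucl n => ((bracketSq x ^ (-s / 2) : ℝ) : ℂ) :=
    Complex.continuous_ofReal.comp_stronglyMeasurable h2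
  refine ⟨⟨StronglyMeasurable.aestronglyMeasurable ?_, h.trans_lt hlt⟩, ?_⟩
  · exact hb.stronglyMeasurable_freqKernel.mul
      (((h1'.mul hF).comp_measurable measurable_fst).mul
        ((h2'.mul hU).comp_measurable measurable_snd))
  · refine (norm_integral_le_lintegral_norm _).trans ?_
    simp only [ofReal_norm]
    refine (ENNReal.toReal_mono hlt.ne h).trans (le_of_eq ?_)
    rw [ENNReal.toReal_mul, ENNReal.toReal_mul, ENNReal.toReal_ofReal hA0]

end

/-! ### The transposed operator -/

section

variable {n : ℕ} {m : ℝ} {b : Eucl n × Eucl n → Eucl n → ℂ} {S : Set (Eucl n × Eucl n)}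

theorem hasTemperateGrowth_bracketSq_rpow (r : ℝ) :
    Function.HasTemperateGrowth fun x : Eucl n => ((bracketSq x ^ r : ℝ) : ℂ) := by
  unfold bracketSq
  fun_prop

/-- A Schwartz function multiplied by a power of the weight. -/
def weighted (r : ℝ) (f : 𝓢(Eucl n, ℂ)) : 𝓢(Eucl n, ℂ) :=
  SchwartzMap.smulLeftCLM ℂ (fun x : Eucl n => ((bracketSq x ^ r : ℝ) : ℂ)) f

theorem weighted_apply (r : ℝ) (f : 𝓢(Eucl n, ℂ)) (x : Eucl n) :
    weighted r f x = ((bracketSq x ^ r : ℝ) : ℂ) * f x := by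
  rw [weighted, SchwartzMap.smulLeftCLM_apply_apply (hasTemperateGrowth_bracketSq_rpow r),
    smul_eq_mul]

theorem bracketSq_rpow_mul_weighted (r : ℝ) (f : 𝓢(Eucl n, ℂ)) (x : Eucl n) :
    ((bracketSq x ^ r : ℝ) : ℂ) * weighted (-r) f x = f x := by
  rw [weighted_apply, ← mul_assoc, ← Complex.ofReal_mul, ← Real.rpow_add (bracketSq_pos x),
    add_neg_cancel, Real.rpow_zero, Complex.ofReal_one, one_mul]

/-- The operator with kernel `freqKernel b`, integrating over the first variable. -/
def freqTranspose (b : Eucl n × Eucl n → Eucl n → ℂ) (f : Eucl n → ℂ) (ζ : Eucl n) : ℂ :=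
  ∫ η, freqKernel b η ζ * f η

theorem IsAmplitude.exists_integrable_freqKernel_schwartz (hb : IsAmplitude m b S) (s : ℝ)
    (f : 𝓢(Eucl n, ℂ)) {U : Eucl n → ℂ} (hU : StronglyMeasurable U) (hU2 : MemLp U 2 volume) :
    Integrable fun w : Eucl n × Eucl n =>
      freqKernel b w.1 w.2 * (f w.1 * (((bracketSq w.2 ^ (-s / 2) : ℝ) : ℂ) * U w.2)) := by
  obtain ⟨A, hA0, hA⟩ := hb.exists_integrable_freqKernel s
  have h := (hA (weighted (-((s - m) / 2)) f) U (SchwartzMap.continuous _).stronglyMeasurable hU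
    (SchwartzMap.memLp (weighted (-((s - m) / 2)) f) 2 volume) hU2).1
  simpa only [bracketSq_rpow_mul_weighted] using h

theorem integral_freqKernel_eq {f g : Eucl n → ℂ}
    (h : Integrable fun w : Eucl n × Eucl n => freqKernel b w.1 w.2 * (f w.1 * g w.2)) :
    ∫ w : Eucl n × Eucl n, freqKernel b w.1 w.2 * (f w.1 * g w.2)
      = ∫ ζ, freqTranspose b f ζ * g ζ := by
  rw [Measure.volume_eq_prod] at h
  have h1 := integral_prod_symm _ h
  rw [← Measure.volume_eq_prod] at h1
  rw [h1]
  refine integral_congr_ae (Eventually.of_forall fun ζ => ?_)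
  simp only [freqTranspose]
  rw [← integral_mul_const]
  simp only [mul_assoc]

theorem IsAmplitude.integrable_freqKernel_schwartz (hb : IsAmplitude m b S)
    (f g : 𝓢(Eucl n, ℂ)) :
    Integrable fun w : Eucl n × Eucl n => freqKernel b w.1 w.2 * (f w.1 * g w.2) := by
  have h := hb.exists_integrable_freqKernel_schwartz 0 f g.continuous.stronglyMeasurable
    (g.memLp 2)
  simpa using h

theorem IsAmplitude.stronglyMeasurable_freqTranspose (hb : IsAmplitude m b S)
    (f : 𝓢(Eucl n, ℂ)) : StronglyMeasurable (freqTranspose b f) := by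
  have h : StronglyMeasurable fun p : Eucl n × Eucl n => freqKernel b p.2 p.1 * f p.2 :=
    (hb.stronglyMeasurable_freqKernel.comp_measurable measurable_swap).mul
      (f.continuous.stronglyMeasurable.comp_measurable measurable_snd)
  exact h.integral_prod_right'

theorem IsAmplitude.exists_norm_freqTranspose_le (hb : IsAmplitude m b S) (f : 𝓢(Eucl n, ℂ))
    (r : ℝ) : ∃ A : ℝ, 0 ≤ A ∧ ∀ ζ, ‖freqTranspose b f ζ‖ * bracketSq ζ ^ r ≤ A := by
  -- For this Sobolev order the weight in `ζ` is exactly `bracketSq ζ ^ r`; the weight in `η` is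
  -- absorbed by the Schwartz function.
  obtain ⟨A, hA0, hA⟩ := hb.exists_norm_freqKernel_le (-2 * r)
  set t := (-2 * r - m) / 2 with ht
  refine ⟨A * ∫ η, ‖weighted (-t) f η‖, mul_nonneg hA0 (integral_nonneg fun _ => norm_nonneg _),
    fun ζ => ?_⟩
  have hζ := bracketSq_rpow_pos ζ r
  rw [← le_div_iff₀ hζ, mul_div_assoc, div_eq_mul_inv, ← mul_assoc, ← integral_const_mul,
    ← integral_mul_const]
  refine norm_integral_le_of_norm_le ((((weighted (-t) f).integrable.norm).const_mul A).mul_const _)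
    (Eventually.of_forall fun η => ?_)
  rw [← div_eq_mul_inv, le_div_iff₀ hζ, norm_mul]
  have h := hA η ζ
  rw [show -(-2 * r) / 2 = r by ring] at h
  have hη := bracketSq_rpow_pos η t
  rw [← bracketSq_rpow_mul_weighted t f η, norm_mul, Complex.norm_real,
    Real.norm_of_nonneg hη.le]
  calc _ = (‖freqKernel b η ζ‖ * (bracketSq η ^ t * bracketSq ζ ^ r)) * ‖weighted (-t) f η‖ := by
        ring
    _ ≤ (A * decay (η - ζ)) * ‖weighted (-t) f η‖ := by gcongr
    _ ≤ (A * 1) * ‖weighted (-t) f η‖ := by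
        gcongr
        exact decay_le_one _
    _ = _ := by rw [mul_one]

theorem IsAmplitude.integrable_pow_mul_freqTranspose (hb : IsAmplitude m b S) (f : 𝓢(Eucl n, ℂ))
    (k : ℕ) : Integrable fun ζ : Eucl n => ‖ζ‖ ^ k * ‖freqTranspose b f ζ‖ := by
  obtain ⟨A, hA0, hA⟩ := hb.exists_norm_freqTranspose_le f (k + ((n : ℝ) + 1) / 2)
  refine (integrable_decay.const_mul A).mono' ?_ (Eventually.of_forall fun ζ => ?_)
  · exact (Continuous.aestronglyMeasurable (by fun_prop)).mul
      (hb.stronglyMeasurable_freqTranspose f).norm.aestronglyMeasurable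
  · rw [Real.norm_of_nonneg (by positivity)]
    have hd : decay ζ * bracketSq ζ ^ (((n : ℝ) + 1) / 2) = 1 := by
      rw [decay, ← Real.rpow_add (bracketSq_pos ζ)]
      convert Real.rpow_zero _ using 2
      ring
    have hle : ‖ζ‖ ^ k ≤ bracketSq ζ ^ (k : ℝ) := by
      rw [Real.rpow_natCast]
      refine pow_le_pow_left₀ (norm_nonneg _) ?_ k
      unfold bracketSq
      nlinarith [sq_nonneg (‖ζ‖ - 1)]
    have h := hA ζ
    rw [Real.rpow_add (bracketSq_pos ζ)] at h
    have hdp := decay_pos ζ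
    have hb0 := bracketSq_rpow_pos ζ (k : ℝ)
    calc ‖ζ‖ ^ k * ‖freqTranspose b f ζ‖
        ≤ bracketSq ζ ^ (k : ℝ) * ‖freqTranspose b f ζ‖
          * (decay ζ * bracketSq ζ ^ (((n : ℝ) + 1) / 2)) := by
          rw [hd, mul_one]
          gcongr
      _ = (‖freqTranspose b f ζ‖ * (bracketSq ζ ^ (k : ℝ) * bracketSq ζ ^ (((n : ℝ) + 1) / 2)))
          * decay ζ := by ring
      _ ≤ A * decay ζ := by gcongr

theorem IsAmplitude.integrable_freqTranspose (hb : IsAmplitude m b S) (f : 𝓢(Eucl n, ℂ)) :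
    Integrable (freqTranspose b f) := by
  have h := hb.integrable_pow_mul_freqTranspose f 0
  simp only [pow_zero, one_mul] at h
  exact (integrable_norm_iff (hb.stronglyMeasurable_freqTranspose f).aestronglyMeasurable).1 h

theorem IsAmplitude.integral_freqKernel_fourier_eq (hb : IsAmplitude m b S) (f ψ : 𝓢(Eucl n, ℂ)) :
    ∫ w : Eucl n × Eucl n, freqKernel b w.1 w.2 * (f w.1 * (𝓕 ψ) w.2)
      = ∫ y, ψ y * 𝓕 (freqTranspose b f) y := by
  rw [integral_freqKernel_eq (hb.integrable_freqKernel_schwartz f (𝓕 ψ))]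
  have h := VectorFourier.integral_fourierIntegral_smul_eq_flip (L := innerₗ (Eucl n))
    (μ := volume) (ν := volume) Real.continuous_fourierChar continuous_inner
    ψ.integrable (hb.integrable_freqTranspose f)
  simp only [smul_eq_mul, flip_innerₗ] at h
  rw [SchwartzMap.fourier_coe]
  simp only [mul_comm (freqTranspose b f _)]
  exact h

/-- A real test function as a Schwartz function. -/
def realToSchwartz (g : Eucl n → ℝ) (hg : ContDiff ℝ ∞ g) (hc : HasCompactSupport g) :
    𝓢(Eucl n, ℂ) :=
  HasCompactSupport.toSchwartzMap (f := fun x => (g x : ℂ)) (hc.comp_left Complex.ofReal_zero)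
    (Complex.ofRealCLM.contDiff.comp hg)

theorem realToSchwartz_apply (g : Eucl n → ℝ) (hg : ContDiff ℝ ∞ g) (hc : HasCompactSupport g)
    (x : Eucl n) : realToSchwartz g hg hc x = (g x : ℂ) := rfl

/-- The transposed operator maps Schwartz functions to test functions. -/
theorem IsAmplitude.exists_transpose (hb : IsAmplitude m b S) (φ : 𝓢(Eucl n, ℂ)) :
    ∃ g : Test n,
      (∀ ψ : 𝓢(Eucl n, ℂ), ∫ w : Eucl n × Eucl n, freqKernel b w.1 w.2 * ((𝓕⁻ φ) w.1 * (𝓕 ψ) w.2)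
        = ∫ y, ψ y * g y) ∧
      (𝓕⁻ (toSchwartz g) : 𝓢(Eucl n, ℂ)) =ᵐ[volume] freqTranspose b (𝓕⁻ φ : 𝓢(Eucl n, ℂ)) ∧
      ∀ O : Set (Eucl n), IsOpen O → (∀ z ξ, z.2 ∈ O → b z ξ * φ z.1 = 0) → ∀ y ∈ O, g y = 0 := by
  set G := freqTranspose b (𝓕⁻ φ : 𝓢(Eucl n, ℂ)) with hG
  have hGi : Integrable G := hb.integrable_freqTranspose _
  have hsm : ContDiff ℝ ∞ (𝓕 G) :=
    Real.contDiff_fourier (N := ⊤) fun k _ => hb.integrable_pow_mul_freqTranspose _ k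
  have hpair : ∀ ψ : 𝓢(Eucl n, ℂ), ∫ w : Eucl n × Eucl n,
      freqKernel b w.1 w.2 * ((𝓕⁻ φ) w.1 * (𝓕 ψ) w.2) = ∫ y, ψ y * 𝓕 G y := fun ψ =>
    hb.integral_freqKernel_fourier_eq _ ψ
  -- Against a test function supported in `O` the space integrand vanishes identically, so the
  -- continuous function `𝓕 G` vanishes on `O`. Taking the complement of the `y`-projection of `S`
  -- then gives compact support.
  have hzero : ∀ O : Set (Eucl n), IsOpen O → (∀ z ξ, z.2 ∈ O → b z ξ * φ z.1 = 0) →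
      ∀ y ∈ O, 𝓕 G y = 0 := by
    intro O hO hbO
    have hae : ∀ᵐ y, y ∈ O → 𝓕 G y = 0 := by
      refine hO.ae_eq_zero_of_integral_contDiff_smul_eq_zero
        (hsm.continuous.locallyIntegrable.locallyIntegrableOn O) fun χ hχ hχc hχO => ?_
      have h := hpair (realToSchwartz χ hχ hχc)
      simp only [realToSchwartz_apply] at h
      simp only [Complex.real_smul]
      rw [← h, ← hb.integral_integral_exp_mul]
      refine integral_eq_zero_of_ae (Eventually.of_forall fun ξ => integral_eq_zero_of_ae
        (Eventually.of_forall fun z => ?_))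
      simp only [realToSchwartz_apply, Pi.zero_apply]
      by_cases hz : z.2 ∈ O
      · rw [mul_assoc, ← mul_assoc (b z ξ), hbO z ξ hz, zero_mul, mul_zero]
      · rw [image_eq_zero_of_notMem_tsupport fun h => hz (hχO h), Complex.ofReal_zero, mul_zero,
          mul_zero]
    exact Measure.eqOn_open_of_ae_eq (g := fun _ => (0 : ℂ))
      ((ae_restrict_iff' hO.measurableSet).2 hae) hO hsm.continuous.continuousOn
      continuousOn_const
  have hS : IsCompact (Prod.snd '' S) := hb.isCompact.image continuous_snd
  have hcs : HasCompactSupport (𝓕 G) := by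
    refine HasCompactSupport.intro hS fun y hy => ?_
    refine hzero (Prod.snd '' S)ᶜ hS.isClosed.isOpen_compl (fun z ξ hz => ?_) y hy
    rw [hb.eq_zero z (fun h => hz ⟨z, h, rfl⟩), zero_mul]
  refine ⟨⟨𝓕 G, hsm, hcs, fun _ _ => trivial⟩, hpair, ?_, hzero⟩
  set gS : 𝓢(Eucl n, ℂ) := hcs.toSchwartzMap hsm with hgS
  have hae := ae_eq_zero_of_integral_contDiff_smul_eq_zero (μ := volume)
    (f := fun x => (𝓕⁻ gS) x - G x)
    (((𝓕⁻ gS).integrable.sub hGi).locallyIntegrable) fun χ hχ hχc => ?_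
  · filter_upwards [hae] with x hx
    exact sub_eq_zero.1 hx
  · set X := realToSchwartz χ hχ hχc with hX
    -- Fourier inversion for `G`, tested weakly: with `ψ = 𝓕⁻ X` the pairing identity compares `∫ G
    -- X` with `∫ X 𝓕⁻ gS`.
    have h1 := hpair (𝓕⁻ X)
    rw [integral_freqKernel_eq (hb.integrable_freqKernel_schwartz _ _),
      FourierTransform.fourier_fourierInv_eq (F := 𝓢(Eucl n, ℂ)) X] at h1
    have h2 := SchwartzMap.integral_fourierInv_mul_eq X gS
    have h3 : ∫ x, X x * (𝓕⁻ gS) x = ∫ x, G x * X x := by rw [← h2, h1]; rfl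
    simp only [Complex.real_smul, mul_sub]
    have hXb : Continuous fun x => (χ x : ℂ) := Complex.continuous_ofReal.comp hχ.continuous
    obtain ⟨C, hC⟩ := hχ.continuous.bounded_above_of_compact_support hχc
    have hC' : ∀ᵐ x, ‖(χ x : ℂ)‖ ≤ C :=
      Eventually.of_forall fun x => by rw [Complex.norm_real]; exact hC x
    rw [integral_sub ((𝓕⁻ gS).integrable.bdd_mul hXb.aestronglyMeasurable hC')
      (hGi.bdd_mul hXb.aestronglyMeasurable hC'), sub_eq_zero]
    simp only [mul_comm (G _)] at h3
    exact h3

end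

/-! ### Sobolev spaces on the Fourier side -/

section

variable {n : ℕ}

theorem besselPotential_neg_fourierInv_apply (s : ℝ) (V : L2 n) (g : 𝓢(Eucl n, ℂ)) :
    besselPotential (Eucl n) ℂ (-s) ((𝓕⁻ V : L2 n) : 𝓢'(Eucl n, ℂ)) g
      = ∫ x, (((bracketSq x ^ (-s / 2) : ℝ) : ℂ) * V x) * (𝓕⁻ g) x := by
  rw [besselPotential, TemperedDistribution.fourierMultiplierCLM_apply,
    ← Lp.fourierInv_toTemperedDistribution_eq,
    FourierTransform.fourier_fourierInv_eq (F := 𝓢'(Eucl n, ℂ)),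
    TemperedDistribution.fourierInv_apply, TemperedDistribution.smulLeftCLM_apply_apply,
    Lp.toTemperedDistribution_apply]
  refine integral_congr_ae (Eventually.of_forall fun x => ?_)
  have hg := hasTemperateGrowth_bracketSq_rpow (n := n) (-s / 2)
  unfold bracketSq at hg
  simp only [smul_eq_mul]
  rw [SchwartzMap.smulLeftCLM_apply_apply hg, smul_eq_mul]
  change ((bracketSq x ^ (-s / 2) : ℝ) : ℂ) * (𝓕⁻ g) x * V x = _
  ring

theorem norm_fourierInv_L2 (V : L2 n) : ‖(𝓕⁻ V : L2 n)‖ = ‖V‖ := by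
  rw [← Lp.norm_fourier_eq, FourierTransform.fourier_fourierInv_eq (F := L2 n)]

/-- The representation of an element of `H^s` by its Fourier transform. -/
theorem MemSobolev.exists_fourier_eq {s : ℝ} {u : 𝓢'(Eucl n, ℂ)} (hu : MemSobolev s 2 u) :
    ∃ U : L2 n, ‖U‖ = sobolevNorm s u ∧
      ∀ g : 𝓢(Eucl n, ℂ), u g = ∫ x, (((bracketSq x ^ (-s / 2) : ℝ) : ℂ) * U x) * (𝓕⁻ g) x := by
  obtain ⟨f, hf⟩ := hu
  refine ⟨𝓕 f, by rw [sobolevNorm_eq hf, Lp.norm_fourier_eq], fun g => ?_⟩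
  rw [← besselPotential_neg_fourierInv_apply, FourierTransform.fourierInv_fourier_eq (F := L2 n),
    (besselPotential_neg_apply_eq_iff s _ _).2 hf]

/-- Every weighted `L²` function is the Fourier transform of an element of `H^s`. -/
theorem exists_memSobolev_of_fourier (s : ℝ) (V : L2 n) :
    ∃ v : 𝓢'(Eucl n, ℂ), MemSobolev s 2 v ∧ sobolevNorm s v = ‖V‖ ∧
      ∀ g : 𝓢(Eucl n, ℂ), v g = ∫ x, (((bracketSq x ^ (-s / 2) : ℝ) : ℂ) * V x) * (𝓕⁻ g) x := by
  have h : besselPotential (Eucl n) ℂ s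
      (besselPotential (Eucl n) ℂ (-s) ((𝓕⁻ V : L2 n) : 𝓢'(Eucl n, ℂ)))
      = ((𝓕⁻ V : L2 n) : 𝓢'(Eucl n, ℂ)) :=
    (besselPotential_neg_apply_eq_iff s _ _).1 rfl
  exact ⟨_, ⟨_, h⟩, by rw [sobolevNorm_eq h, norm_fourierInv_L2],
    besselPotential_neg_fourierInv_apply s V⟩

variable {m : ℝ} {b : Eucl n × Eucl n → Eucl n → ℂ} {S : Set (Eucl n × Eucl n)}

/-- The bounded bilinear form of the operator is represented by a bounded operator on `L²`. -/
theorem IsAmplitude.exists_L2_bound (hb : IsAmplitude m b S) (s : ℝ) :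
    ∃ A : ℝ, 0 ≤ A ∧ ∀ U : L2 n, ∃ V : L2 n, ‖V‖ ≤ A * ‖U‖ ∧ ∀ f : 𝓢(Eucl n, ℂ),
      ∫ x, (((bracketSq x ^ (-(s - m) / 2) : ℝ) : ℂ) * V x) * f x
        = ∫ w : Eucl n × Eucl n, freqKernel b w.1 w.2 *
            (f w.1 * (((bracketSq w.2 ^ (-s / 2) : ℝ) : ℂ) * U w.2)) := by
  obtain ⟨A, hA0, hA⟩ := hb.exists_integrable_freqKernel s
  refine ⟨A, hA0, fun U => ?_⟩
  set V₀ : Eucl n → ℂ := fun η => ∫ ζ, freqKernel b η ζ *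
    (((bracketSq η ^ ((s - m) / 2) : ℝ) : ℂ) * (((bracketSq ζ ^ (-s / 2) : ℝ) : ℂ) * U ζ)) with hV₀
  have hint : ∀ F : L2 n, Integrable fun w : Eucl n × Eucl n => freqKernel b w.1 w.2 *
        ((((bracketSq w.1 ^ ((s - m) / 2) : ℝ) : ℂ) * F w.1)
          * (((bracketSq w.2 ^ (-s / 2) : ℝ) : ℂ) * U w.2)) := fun F =>
    (hA F U (Lp.stronglyMeasurable F) (Lp.stronglyMeasurable U) (Lp.memLp F) (Lp.memLp U)).1
  have hmul : ∀ (F : L2 n) (η : Eucl n), V₀ η * F η = ∫ ζ, freqKernel b η ζ *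
        ((((bracketSq η ^ ((s - m) / 2) : ℝ) : ℂ) * F η)
          * (((bracketSq ζ ^ (-s / 2) : ℝ) : ℂ) * U ζ)) := by
    intro F η
    rw [hV₀, ← integral_mul_const]
    refine integral_congr_ae (Eventually.of_forall fun ζ => ?_)
    simp only
    ring
  have hVi : ∀ F : L2 n, Integrable fun η => V₀ η * F η := by
    intro F
    simp only [hmul]
    exact (hint F).integral_prod_left
  have hVeq : ∀ F : L2 n, ∫ η, V₀ η * F η = ∫ w : Eucl n × Eucl n, freqKernel b w.1 w.2 *
        ((((bracketSq w.1 ^ ((s - m) / 2) : ℝ) : ℂ) * F w.1)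
          * (((bracketSq w.2 ^ (-s / 2) : ℝ) : ℂ) * U w.2)) := by
    intro F
    simp only [hmul]
    have h := hint F
    rw [Measure.volume_eq_prod] at h ⊢
    exact (integral_prod _ h).symm
  let ℓ₀ : L2 n →ₗ[ℂ] ℂ :=
    { toFun := fun F => ∫ η, V₀ η * F η
      map_add' := by
        intro F G
        rw [← integral_add (hVi F) (hVi G)]
        refine integral_congr_ae ?_
        filter_upwards [Lp.coeFn_add F G] with η hη
        rw [hη, Pi.add_apply, mul_add]
      map_smul' := by
        intro c F
        rw [RingHom.id_apply, smul_eq_mul, ← integral_const_mul]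
        refine integral_congr_ae ?_
        filter_upwards [Lp.coeFn_smul c F] with η hη
        rw [hη, Pi.smul_apply, smul_eq_mul]
        ring }
  have hℓ : ∀ F : L2 n, ‖ℓ₀ F‖ ≤ (A * ‖U‖) * ‖F‖ := by
    intro F
    change ‖∫ η, V₀ η * F η‖ ≤ _
    rw [hVeq]
    refine (hA F U (Lp.stronglyMeasurable F) (Lp.stronglyMeasurable U) (Lp.memLp F)
      (Lp.memLp U)).2.trans (le_of_eq ?_)
    rw [Lp.norm_def, Lp.norm_def]
    ring
  -- `V₀` is only known through its integrals against `L²` functions, so Riesz' theorem supplies the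
  -- `L²` element. The inner product is conjugate linear in `w`, hence the answer is `star w`.
  set w : L2 n := (InnerProductSpace.toDual ℂ (L2 n)).symm (ℓ₀.mkContinuous _ hℓ) with hw
  have hwin : ∀ F : L2 n, inner ℂ w F = ∫ η, V₀ η * F η := fun F =>
    InnerProductSpace.toDual_symm_apply
  refine ⟨star w, ?_, fun f => ?_⟩
  · have hstar : ‖star w‖ = ‖w‖ := by
      rw [Lp.norm_def, Lp.norm_def, eLpNorm_congr_ae (Lp.coeFn_star w)]
      congr 1
      exact eLpNorm_congr_norm_ae (Eventually.of_forall fun x => norm_star _)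
    rw [hstar, hw, LinearIsometryEquiv.norm_map]
    exact LinearMap.mkContinuous_norm_le _ (by positivity) _
  · set f' : 𝓢(Eucl n, ℂ) := weighted (-((s - m) / 2)) f with hf'
    have h1 := hwin (f'.toLp 2)
    have hcoe := f'.coeFn_toLp 2 (volume : Measure (Eucl n))
    rw [L2.inner_def] at h1
    have h2 : ∫ η, V₀ η * (f'.toLp 2 : L2 n) η = ∫ η, V₀ η * f' η := by
      refine integral_congr_ae ?_
      filter_upwards [hcoe] with η hη
      rw [hη]
    have h3 := (hA f' U f'.continuous.stronglyMeasurable (Lp.stronglyMeasurable U)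
      (f'.memLp 2 volume) (Lp.memLp U)).1
    have h4 : ∫ η, V₀ η * f' η = ∫ w : Eucl n × Eucl n, freqKernel b w.1 w.2 *
            (f w.1 * (((bracketSq w.2 ^ (-s / 2) : ℝ) : ℂ) * U w.2)) := by
      simp only [hf', bracketSq_rpow_mul_weighted] at h3
      rw [Measure.volume_eq_prod] at h3 ⊢
      rw [integral_prod _ h3]
      refine integral_congr_ae (Eventually.of_forall fun η => ?_)
      simp only [hV₀]
      rw [← integral_mul_const]
      refine integral_congr_ae (Eventually.of_forall fun ζ => ?_)
      simp only
      rw [← bracketSq_rpow_mul_weighted ((s - m) / 2) f η]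
      ring
    rw [← h4, ← h2, ← h1]
    refine integral_congr_ae ?_
    filter_upwards [Lp.coeFn_star w, hcoe] with x hx hfx
    rw [hx, hfx, Pi.star_apply, hf', weighted_apply, RCLike.inner_apply, neg_div]
    simp only [RCLike.star_def]
    ring

end

/-! ### Cutoff functions and partitions of unity -/

section Smooth

variable {E : Type*} [NormedAddCommGroup E] [NormedSpace ℝ E] [FiniteDimensional ℝ E]

/-- The value `1` on a neighbourhood of `T`, not just on `T`, keeps the support of `(κ - 1) f`
disjoint from `T`. -/
theorem exists_cutoff {T : Set E} (hT : IsCompact T) :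
    ∃ κ : E → ℝ, ContDiff ℝ ∞ κ ∧ HasCompactSupport κ ∧ ∀ᶠ x in 𝓝ˢ T, κ x = 1 := by
  obtain ⟨T', hT', hsub⟩ := exists_compact_superset hT
  obtain ⟨f, h1, h2, -⟩ := exists_contMDiffMap_one_nhds_of_subset_interior (n := ⊤)
    (modelWithCornersSelf ℝ E) hT.isClosed hsub
  exact ⟨f, f.contMDiff.contDiff, HasCompactSupport.intro hT' h2, h1⟩

theorem exists_partition {T : Set E} (hT : IsCompact T) {p : Set E → Prop}
    (h : ∀ x ∈ T, ∃ U, p U ∧ IsOpen U ∧ x ∈ U) :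
    ∃ (t : Finset T) (ρ : t → E → ℝ), (∀ i, ContDiff ℝ ∞ (ρ i)) ∧
      (∀ i, ∃ U, p U ∧ tsupport (ρ i) ⊆ U) ∧ ∀ x ∈ T, ∑ i, ρ i x = 1 := by
  choose U hpU hoU hxU using h
  obtain ⟨t, ht⟩ := hT.elim_finite_subcover (fun x : T => U x x.2) (fun x => hoU x x.2)
    (fun x hx => Set.mem_iUnion.2 ⟨⟨x, hx⟩, hxU x hx⟩)
  obtain ⟨f, hf⟩ := SmoothPartitionOfUnity.exists_isSubordinate (modelWithCornersSelf ℝ E)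
    hT.isClosed (fun i : t => U i.1 i.1.2) (fun i => hoU _ _) (fun x hx => by
      obtain ⟨i, hi, hxi⟩ := Set.mem_iUnion₂.1 (ht hx)
      exact Set.mem_iUnion.2 ⟨⟨i, hi⟩, hxi⟩)
  refine ⟨t, fun i => f i, fun i => (f i).contMDiff.contDiff, fun i => ⟨_, hpU i.1 i.1.2, hf i⟩,
    fun x hx => ?_⟩
  rw [← finsum_eq_sum_of_fintype]
  exact f.sum_eq_one hx

end Smooth

/-- The product of a smooth function and a test function. -/
def smoothMul {E : Type*} [NormedAddCommGroup E] [NormedSpace ℝ E] {χ : E → ℝ}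
    (hχ : ContDiff ℝ ∞ χ) (f : 𝓓((⊤ : Opens E), ℂ)) : 𝓓((⊤ : Opens E), ℂ) where
  toFun x := χ x • f x
  contDiff' := hχ.smul f.contDiff
  hasCompactSupport' := HasCompactSupport.intro f.hasCompactSupport fun x hx => by
    rw [image_eq_zero_of_notMem_tsupport hx, smul_zero]
  tsupport_subset' := fun _ _ => trivial

theorem smoothMul_apply {E : Type*} [NormedAddCommGroup E] [NormedSpace ℝ E] {χ : E → ℝ}
    (hχ : ContDiff ℝ ∞ χ) (f : 𝓓((⊤ : Opens E), ℂ)) (x : E) : smoothMul hχ f x = χ x • f x := rfl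

/-- A distribution vanishes on the test functions whose support does not meet its support. -/
theorem distribution_eq_zero_of_disjoint {E : Type*} [NormedAddCommGroup E] [NormedSpace ℝ E]
    [FiniteDimensional ℝ E] (K : 𝓓((⊤ : Opens E), ℂ) →L[ℂ] ℂ) (f : 𝓓((⊤ : Opens E), ℂ))
    (h : Disjoint (tsupport f) (dsupport K)) : K f = 0 := by
  obtain ⟨t, ρ, hρ, hU, hsum⟩ := exists_partition (p := IsVanishingOn K) f.hasCompactSupport
    (fun x hx => (notMem_dsupport_iff x).1 (Set.disjoint_left.1 h hx))
  have hf : f = ∑ i, smoothMul (hρ i) f := by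
    refine TestFunction.ext fun x => ?_
    rw [FunLike.coe_sum, Finset.sum_apply]
    simp only [smoothMul_apply]
    rw [← Finset.sum_smul]
    by_cases hx : x ∈ tsupport f
    · rw [hsum x hx, one_smul]
    · rw [image_eq_zero_of_notMem_tsupport hx, smul_zero]
  rw [hf, map_sum]
  refine Finset.sum_eq_zero fun i _ => ?_
  obtain ⟨U, hVU, hsub⟩ := hU i
  exact hVU _ ((tsupport_smul_subset_left (ρ i) f).trans hsub)

section

variable {n : ℕ}

theorem toSchwartz_apply (g : Test n) (x : Eucl n) : toSchwartz g x = g x := rfl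

theorem tempered_eq_zero_of_disjoint (u : 𝓢'(Eucl n, ℂ)) (g : Test n)
    (h : Disjoint (tsupport g) (dsupport u)) : u (toSchwartz g) = 0 := by
  obtain ⟨t, ρ, hρ, hU, hsum⟩ := exists_partition (p := IsVanishingOn u) g.hasCompactSupport
    (fun x hx => (notMem_dsupport_iff x).1 (Set.disjoint_left.1 h hx))
  have hf : toSchwartz g = ∑ i, toSchwartz (smoothMul (hρ i) g) := by
    ext x
    rw [FunLike.coe_sum, Finset.sum_apply]
    simp only [toSchwartz_apply, smoothMul_apply]
    rw [← Finset.sum_smul]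
    by_cases hx : x ∈ tsupport g
    · rw [hsum x hx, one_smul]
    · rw [image_eq_zero_of_notMem_tsupport hx, smul_zero]
  rw [hf, map_sum]
  refine Finset.sum_eq_zero fun i _ => ?_
  obtain ⟨U, hVU, hsub⟩ := hU i
  exact hVU _ ((tsupport_smul_subset_left (ρ i) g).trans hsub)

/-! ### Density of the test functions -/

/-- The product of a Schwartz function and a smooth function with compact support. -/
def cutTest {χ : Eucl n → ℝ} (hχ : ContDiff ℝ ∞ χ) (hc : HasCompactSupport χ)
    (f : 𝓢(Eucl n, ℂ)) : Test n where
  toFun x := χ x • f x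
  contDiff' := hχ.smul (f.smooth ⊤)
  hasCompactSupport' := HasCompactSupport.intro hc fun x hx => by
    rw [image_eq_zero_of_notMem_tsupport hx, zero_smul]
  tsupport_subset' := fun _ _ => trivial

theorem cutTest_apply {χ : Eucl n → ℝ} (hχ : ContDiff ℝ ∞ χ) (hc : HasCompactSupport χ)
    (f : 𝓢(Eucl n, ℂ)) (x : Eucl n) : cutTest hχ hc f x = χ x • f x := rfl

/-- The derivatives of a dilated cutoff function minus `1` tend to zero, up to a factor `1 + |x|`. -/
theorem exists_norm_iteratedFDeriv_cutoff_sub_one_le {χ : Eucl n → ℝ} (hχ : IsCutoff χ) (i : ℕ) :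
    ∃ C : ℝ, 0 ≤ C ∧ ∀ ε : ℝ, 0 < ε → ε ≤ 1 → ∀ x,
      ‖iteratedFDeriv ℝ i (fun x => χ (ε • x) - 1) x‖ ≤ ε * (C * (1 + ‖x‖)) := by
  rcases Nat.eq_zero_or_pos i with rfl | hi
  · obtain ⟨C, hC⟩ := hχ.1.continuous.bounded_above_of_compact_support hχ.2.1
    have hC0 : 0 ≤ C := (norm_nonneg _).trans (hC 0)
    obtain ⟨δ, hδ, hball⟩ := Metric.eventually_nhds_iff.1 hχ.2.2
    refine ⟨(C + 1) / δ, by positivity, fun ε hε _ x => ?_⟩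
    rw [norm_iteratedFDeriv_zero]
    by_cases hx : dist (ε • x) 0 < δ
    · rw [hball hx, sub_self, norm_zero]
      positivity
    -- Here `ε‖x‖ ≥ δ`, so a bounded quantity may be multiplied by `ε‖x‖ / δ`.
    · rw [dist_zero_right, norm_smul, Real.norm_of_nonneg hε.le, not_lt] at hx
      calc ‖χ (ε • x) - 1‖ ≤ ‖χ (ε • x)‖ + ‖(1 : ℝ)‖ := norm_sub_le _ _
        _ ≤ C + 1 := by
            rw [norm_one]
            gcongr
            exact hC _
        _ ≤ (C + 1) / δ * (ε * ‖x‖) := by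
            rw [div_mul_eq_mul_div, le_div_iff₀ hδ]
            gcongr
        _ = ε * ((C + 1) / δ * ‖x‖) := by ring
        _ ≤ _ := by
            gcongr
            linarith
  · obtain ⟨C, hC⟩ := (hχ.1.continuous_iteratedFDeriv (m := i)
      (by exact_mod_cast le_top)).bounded_above_of_compact_support (hχ.2.1.iteratedFDeriv i)
    have hC0 : 0 ≤ C := (norm_nonneg _).trans (hC 0)
    refine ⟨C, hC0, fun ε hε hε1 x => ?_⟩
    have hd : ContDiff ℝ i fun x : Eucl n => χ (ε • x) :=
      (hχ.1.of_le (by exact_mod_cast le_top)).comp (contDiff_const_smul ε)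
    have h1 : iteratedFDeriv ℝ i (fun x => χ (ε • x) - 1) x
        = iteratedFDeriv ℝ i (fun x => χ (ε • x)) x := by
      change iteratedFDeriv ℝ i ((fun x => χ (ε • x)) - fun _ => (1 : ℝ)) x = _
      rw [iteratedFDeriv_sub_apply hd.contDiffAt contDiffAt_const,
        iteratedFDeriv_const_of_ne hi.ne', Pi.zero_apply, sub_zero]
    rw [h1, iteratedFDeriv_comp_const_smul ε (hχ.1.of_le (by exact_mod_cast le_top)), norm_smul,
      norm_pow, Real.norm_of_nonneg hε.le]
    have h2 : ε ^ i ≤ ε := by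
      calc ε ^ i ≤ ε ^ 1 := pow_le_pow_of_le_one hε.le hε1 hi
        _ = ε := pow_one ε
    calc ε ^ i * ‖iteratedFDeriv ℝ i χ (ε • x)‖ ≤ ε * C := by
          gcongr
          exact hC _
      _ ≤ ε * (C * (1 + ‖x‖)) := by
          gcongr
          exact le_mul_of_one_le_right hC0 (by linarith [norm_nonneg x])

theorem exists_isCutoff_dilate {χ : Eucl n → ℝ} (hχ : IsCutoff χ) {ε : ℝ} (hε : ε ≠ 0) :
    ContDiff ℝ ∞ (fun x : Eucl n => χ (ε • x)) ∧ HasCompactSupport fun x : Eucl n => χ (ε • x) :=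
  ⟨hχ.1.comp (contDiff_const_smul ε), hχ.2.1.comp_smul hε⟩

/-- Test functions are dense in the Schwartz space. -/
theorem tendsto_cutTest {χ : Eucl n → ℝ} (hχ : IsCutoff χ) (f : 𝓢(Eucl n, ℂ)) :
    Tendsto (fun k : ℕ => toSchwartz (cutTest
      (exists_isCutoff_dilate hχ (Nat.cast_add_one_ne_zero (R := ℝ) k |> inv_ne_zero)).1
      (exists_isCutoff_dilate hχ (Nat.cast_add_one_ne_zero (R := ℝ) k |> inv_ne_zero)).2 f))
      atTop (𝓝 f) := by
  rw [(schwartz_withSeminorms ℝ (Eucl n) ℂ).tendsto_nhds]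
  rintro ⟨a, l⟩ ε hε
  choose C hC0 hC using exists_norm_iteratedFDeriv_cutoff_sub_one_le hχ
  -- The factor `1 + ‖x‖` costs one more power of `‖x‖`, hence the seminorms with `a + 1`.
  set M : ℝ := ∑ i ∈ Finset.range (l + 1), (l.choose i : ℝ) * (C i *
    (SchwartzMap.seminorm ℝ a (l - i) f + SchwartzMap.seminorm ℝ (a + 1) (l - i) f)) with hM
  have hM0 : 0 ≤ M := Finset.sum_nonneg fun i _ => mul_nonneg (by positivity)
    (mul_nonneg (hC0 i) (add_nonneg (apply_nonneg _ _) (apply_nonneg _ _)))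
  have hlim : Tendsto (fun k : ℕ => ((k : ℝ) + 1)⁻¹ * M) atTop (𝓝 0) := by
    have h := (tendsto_one_div_add_atTop_nhds_zero_nat (𝕜 := ℝ)).mul_const M
    simpa using h
  filter_upwards [hlim.eventually_lt_const hε] with k hk
  refine lt_of_le_of_lt ?_ hk
  have hk0 : (0 : ℝ) < ((k : ℝ) + 1)⁻¹ := by positivity
  have hk1 : ((k : ℝ) + 1)⁻¹ ≤ 1 := inv_le_one_of_one_le₀ (by linarith [k.cast_nonneg (α := ℝ)])
  refine SchwartzMap.seminorm_le_bound ℝ a l _ (by positivity) fun x => ?_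
  set τ : Eucl n → ℝ := fun x => χ (((k : ℝ) + 1)⁻¹ • x) - 1 with hτ
  have hτd : ContDiff ℝ ∞ τ := (exists_isCutoff_dilate hχ hk0.ne').1.sub contDiff_const
  rw [show ⇑(toSchwartz (cutTest _ _ f) - f) = fun x => τ x • f x by
    ext x
    simp only [sub_apply, toSchwartz_apply, cutTest_apply, hτ, sub_smul, one_smul]]
  have h := norm_iteratedFDeriv_smul_le hτd (f.smooth ⊤) x (n := l) (by exact_mod_cast le_top)
  calc ‖x‖ ^ a * ‖iteratedFDeriv ℝ l (fun x => τ x • f x) x‖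
      ≤ ‖x‖ ^ a * ∑ i ∈ Finset.range (l + 1), (l.choose i : ℝ) * ‖iteratedFDeriv ℝ i τ x‖
          * ‖iteratedFDeriv ℝ (l - i) f x‖ := by gcongr
    _ ≤ ((k : ℝ) + 1)⁻¹ * M := by
        rw [hM, Finset.mul_sum, Finset.mul_sum]
        refine Finset.sum_le_sum fun i _ => ?_
        have h1 := hC i _ hk0 hk1 x
        have h2 := SchwartzMap.le_seminorm ℝ a (l - i) f x
        have h3 := SchwartzMap.le_seminorm ℝ (a + 1) (l - i) f x
        have hCi := hC0 i
        calc ‖x‖ ^ a * ((l.choose i : ℝ) * ‖iteratedFDeriv ℝ i τ x‖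
              * ‖iteratedFDeriv ℝ (l - i) f x‖)
            ≤ ‖x‖ ^ a * ((l.choose i : ℝ) * (((k : ℝ) + 1)⁻¹ * (C i * (1 + ‖x‖)))
              * ‖iteratedFDeriv ℝ (l - i) f x‖) := by gcongr
          _ = ((k : ℝ) + 1)⁻¹ * ((l.choose i : ℝ) * (C i *
              (‖x‖ ^ a * ‖iteratedFDeriv ℝ (l - i) f x‖
                + ‖x‖ ^ (a + 1) * ‖iteratedFDeriv ℝ (l - i) f x‖))) := by ring
          _ ≤ _ := by gcongr

/-- Cutting off approximates `f` without enlarging its support. -/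
theorem tempered_apply_eq_zero {u : 𝓢'(Eucl n, ℂ)} {f : 𝓢(Eucl n, ℂ)}
    (h : ∀ φ : Test n, tsupport φ ⊆ tsupport f → u (toSchwartz φ) = 0) : u f = 0 := by
  obtain ⟨χ, hχ⟩ := exists_isCutoff n
  have hlim := ((map_continuous u).tendsto f).comp (tendsto_cutTest hχ f)
  refine tendsto_nhds_unique (hlim.congr fun k => ?_) tendsto_const_nhds
  exact h _ (tsupport_smul_subset_right _ f)

theorem tempered_ext {u v : 𝓢'(Eucl n, ℂ)}
    (h : ∀ φ : Test n, u (toSchwartz φ) = v (toSchwartz φ)) : u = v := by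
  rw [← sub_eq_zero]
  ext f
  refine tempered_apply_eq_zero fun φ _ => ?_
  change u _ - v _ = 0
  rw [h, sub_self]

theorem dsupport_subset_of_test {v : 𝓢'(Eucl n, ℂ)} {T : Set (Eucl n)} (hT : IsClosed T)
    (h : ∀ φ : Test n, Disjoint (tsupport φ) T → v (toSchwartz φ) = 0) : dsupport v ⊆ T := by
  intro x hx
  refine (mem_dsupport_iff x).1 hx T (fun f hf => tempered_apply_eq_zero fun φ hφ => ?_) hT
  exact h φ (Set.disjoint_left.2 fun y hy => (hf (hφ hy)))

/-! ### Supports of square integrable functions -/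

theorem dsupport_subset_of_supportedIn {f : L2 n} {C : Set (Eucl n)} (hC : IsClosed C)
    (h : SupportedIn f C) : dsupport (f : 𝓢'(Eucl n, ℂ)) ⊆ C := by
  refine dsupport_subset_of_test hC fun φ hφ => ?_
  rw [Lp.toTemperedDistribution_apply]
  refine integral_eq_zero_of_ae ?_
  filter_upwards [h] with x hx
  by_cases hxC : x ∈ C
  · rw [toSchwartz_apply,
      image_eq_zero_of_notMem_tsupport fun h => Set.disjoint_left.1 hφ h hxC]
    simp
  · rw [hx hxC]
    simp

theorem supportedIn_of_dsupport_subset {f : L2 n} {C : Set (Eucl n)} (hC : IsClosed C)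
    (h : dsupport (f : 𝓢'(Eucl n, ℂ)) ⊆ C) : SupportedIn f C := by
  have hae := hC.isOpen_compl.ae_eq_zero_of_integral_contDiff_smul_eq_zero (μ := volume)
    (f := f) (((Lp.memLp f).locallyIntegrable (by norm_num)).locallyIntegrableOn _)
    fun χ hχ hχc hχC => ?_
  · exact hae
  · let g : Test n := ⟨fun x => (χ x : ℂ), Complex.ofRealCLM.contDiff.comp hχ,
      hχc.comp_left Complex.ofReal_zero, fun _ _ => trivial⟩
    have hg : tsupport g ⊆ tsupport χ := closure_mono fun x hx hx' => hx (by
      change (χ x : ℂ) = 0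
      rw [hx', Complex.ofReal_zero])
    have h0 := tempered_eq_zero_of_disjoint (f : 𝓢'(Eucl n, ℂ)) g
      (Set.disjoint_left.2 fun x hx hx' => hχC (hg hx) (h hx'))
    rw [Lp.toTemperedDistribution_apply] at h0
    rw [← h0]
    rfl

end

/-! ### Properly supported operators -/

section

variable {n : ℕ} {m : ℝ}

/-- The support of `(θ - 1)(φ ⊗ ψ)` misses that of `K`, since `T` contains every point of `dsupport
K` over `tsupport φ × tsupport ψ`. -/
theorem smoothMul_tensor_eq {K : Kernel2 n} {φ ψ : Test n} {T : Set (Eucl n × Eucl n)}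
    (hT : ∀ z ∈ dsupport K, z.1 ∈ tsupport φ → z.2 ∈ tsupport ψ → z ∈ T)
    {θ : Eucl n × Eucl n → ℝ} (hθ : ContDiff ℝ ∞ θ) (hθT : ∀ᶠ z in 𝓝ˢ T, θ z = 1) :
    K (smoothMul hθ (tensor φ ψ)) = K (tensor φ ψ) := by
  rw [← sub_eq_zero, ← map_sub]
  refine distribution_eq_zero_of_disjoint K _ (Set.disjoint_left.2 fun z hz hzK => ?_)
  have hval : ∀ y, (smoothMul hθ (tensor φ ψ) - tensor φ ψ) y = (θ y - 1) • (φ y.1 * ψ y.2) := by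
    intro y
    rw [sub_apply, smoothMul_apply, sub_smul, one_smul]
    rfl
  have h1 : z.1 ∈ tsupport φ := by
    by_contra hφ
    refine notMem_tsupport_iff_eventuallyEq.2 ?_ hz
    have h := continuous_fst.continuousAt.eventually (notMem_tsupport_iff_eventuallyEq.1 hφ)
    filter_upwards [h] with y hy
    rw [hval, hy, Pi.zero_apply, Pi.zero_apply, zero_mul, smul_zero]
  have h2 : z.2 ∈ tsupport ψ := by
    by_contra hψ
    refine notMem_tsupport_iff_eventuallyEq.2 ?_ hz
    have h := continuous_snd.continuousAt.eventually (notMem_tsupport_iff_eventuallyEq.1 hψ)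
    filter_upwards [h] with y hy
    rw [hval, hy, Pi.zero_apply, Pi.zero_apply, mul_zero, smul_zero]
  refine notMem_tsupport_iff_eventuallyEq.2 ?_ hz
  filter_upwards [(eventually_nhdsSet_iff_forall.1 hθT) z (hT z hzK h1 h2)] with y hy
  rw [hval, hy, sub_self, zero_smul, Pi.zero_apply]

theorem kernel_smoothMul_tensor_eq {K : Kernel2 n} {a : Eucl n × Eucl n → Eucl n → ℂ}
    (ha : IsSymbol m a) (hosc : ∀ Ψ, HasOscPairing a Ψ (K Ψ)) {θ : Eucl n × Eucl n → ℝ}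
    (hθ : ContDiff ℝ ∞ θ) (hc : HasCompactSupport θ) (φ ψ : Test n) :
    K (smoothMul hθ (tensor φ ψ)) = ∫ w : Eucl n × Eucl n,
      freqKernel (fun z ξ => (θ z : ℂ) * a z ξ) w.1 w.2
        * ((𝓕⁻ (toSchwartz φ)) w.1 * (𝓕 (toSchwartz ψ)) w.2) := by
  refine (ha.isAmplitude hθ hc).eq_of_hasOscPairing (hosc _) _ _ fun z ξ => ?_
  rw [smoothMul_apply, Complex.real_smul, toSchwartz_apply, toSchwartz_apply]
  change a z ξ * ((θ z : ℂ) * (φ z.1 * ψ z.2)) = _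
  ring

theorem test_eq_of_integral_eq {g g' : Test n}
    (h : ∀ ψ : Test n, ∫ y, ψ y * g y = ∫ y, ψ y * g' y) : g = g' := by
  have hae := ae_eq_zero_of_integral_contDiff_smul_eq_zero (μ := volume)
    (f := fun x => g x - g' x) (g.continuous.sub g'.continuous).locallyIntegrable
    fun χ hχ hχc => ?_
  · have heq : (fun x => g x - g' x) = fun _ => 0 :=
      Continuous.ae_eq_iff_eq volume (g.continuous.sub g'.continuous) continuous_const |>.1 hae
    exact TestFunction.ext fun x => sub_eq_zero.1 (congrFun heq x)
  · have h0 := h ⟨fun x => (χ x : ℂ), Complex.ofRealCLM.contDiff.comp hχ,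
      hχc.comp_left Complex.ofReal_zero, fun _ _ => trivial⟩
    have hi : ∀ f : Test n, Integrable fun x => (χ x : ℂ) * f x := fun f =>
      ((Complex.continuous_ofReal.comp hχ.continuous).mul
        f.continuous).integrable_of_hasCompactSupport f.hasCompactSupport.mul_left
    simp only [Complex.real_smul, mul_sub]
    rw [integral_sub (hi g) (hi g'), sub_eq_zero]
    exact h0

/-- A properly supported pseudo-differential operator has a transpose on test functions. -/
theorem exists_isTransposeApply {P : Test n →ₗ[ℂ] Distr n} {K : Kernel2 n}
    (hPK : HasSchwartzKernel P K) (hK : IsPseudoDiffKernel m K) (hproper : IsProperlySupported K)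
    (φ : Test n) : ∃ g : Test n, IsTransposeApply P φ g := by
  obtain ⟨a, ha, hosc⟩ := hK
  -- Properness of the first projection gives one cutoff that serves every `ψ`.
  obtain ⟨θ, hθ, hθc, hθ1⟩ := exists_cutoff (hproper _ φ.hasCompactSupport).1
  obtain ⟨g, hg, -, -⟩ := (ha.isAmplitude hθ hθc).exists_transpose (toSchwartz φ)
  refine ⟨g, fun ψ => ?_⟩
  rw [hPK, ← smoothMul_tensor_eq (T := dsupport K ∩ Prod.fst ⁻¹' tsupport φ)
      (fun z hz h1 _ => ⟨hz, h1⟩) hθ hθ1,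
    kernel_smoothMul_tensor_eq ha hosc hθ hθc, hg]
  rfl

/-- One test function `g` represents the form both against test functions and against weighted `L²`
densities. This lets the transpose act on elements of `H^s` through their Fourier transforms. -/
theorem IsAmplitude.exists_transpose_of_fourier {b : Eucl n × Eucl n → Eucl n → ℂ}
    {S : Set (Eucl n × Eucl n)} (hb : IsAmplitude m b S) (φ : Test n) :
    ∃ g : Test n,
      (∀ ψ : Test n, ∫ w : Eucl n × Eucl n, freqKernel b w.1 w.2
        * ((𝓕⁻ (toSchwartz φ)) w.1 * (𝓕 (toSchwartz ψ)) w.2) = ∫ y, ψ y * g y) ∧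
      (∀ (s : ℝ) (U : L2 n), ∫ w : Eucl n × Eucl n, freqKernel b w.1 w.2
          * ((𝓕⁻ (toSchwartz φ)) w.1 * (((bracketSq w.2 ^ (-s / 2) : ℝ) : ℂ) * U w.2))
        = ∫ x, (((bracketSq x ^ (-s / 2) : ℝ) : ℂ) * U x) * (𝓕⁻ (toSchwartz g)) x) ∧
      (Disjoint (tsupport φ) (Prod.fst '' S) → g = 0) := by
  obtain ⟨g, h1, h2, h3⟩ := hb.exists_transpose (toSchwartz φ)
  refine ⟨g, fun ψ => h1 (toSchwartz ψ), fun s U => ?_, fun hd => ?_⟩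
  · have hi := hb.exists_integrable_freqKernel_schwartz s (𝓕⁻ (toSchwartz φ))
      (Lp.stronglyMeasurable U) (Lp.memLp U)
    refine (integral_freqKernel_eq (g := fun x => ((bracketSq x ^ (-s / 2) : ℝ) : ℂ) * U x)
      hi).trans ?_
    refine integral_congr_ae ?_
    filter_upwards [h2] with x hx
    rw [hx, mul_comm]
  · refine TestFunction.ext fun y => h3 Set.univ isOpen_univ (fun z ξ _ => ?_) y (Set.mem_univ y)
    by_cases hz : z ∈ S
    · have hφ : z.1 ∉ tsupport φ := fun h => Set.disjoint_left.1 hd h ⟨z, hz, rfl⟩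
      rw [toSchwartz_apply, image_eq_zero_of_notMem_tsupport hφ, mul_zero]
    · rw [hb.eq_zero z hz, zero_mul]

/-- A properly supported pseudo-differential operator acts boundedly on the elements of `H^s` with
support in a fixed compact set. -/
theorem exists_bounded_image {P : Test n →ₗ[ℂ] Distr n} {K : Kernel2 n}
    (hPK : HasSchwartzKernel P K) (hK : IsPseudoDiffKernel m K) (hproper : IsProperlySupported K)
    (s : ℝ) {C : Set (Eucl n)} (hC : IsCompact C) :
    ∃ C' : Set (Eucl n), IsCompact C' ∧ ∃ A : ℝ, ∀ u : 𝓢'(Eucl n, ℂ), MemSobolev s 2 u →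
      dsupport u ⊆ C → ∃ v : 𝓢'(Eucl n, ℂ), MemSobolev (s - m) 2 v ∧ dsupport v ⊆ C' ∧
        sobolevNorm (s - m) v ≤ A * sobolevNorm s u ∧
        ∀ φ g : Test n, IsTransposeApply P φ g → v (toSchwartz φ) = u (toSchwartz g) := by
  have htr := exists_isTransposeApply hPK hK hproper
  obtain ⟨a, ha, hosc⟩ := hK
  obtain ⟨κ, hκ, hκc, hκ1⟩ := exists_cutoff hC
  -- Properness of the second projection makes `Θ` independent of `φ`, so a single amplitude yields
  -- one constant for all `u` supported in `C`.
  obtain ⟨Θ, hΘ, hΘc, hΘ1⟩ := exists_cutoff (hproper _ hκc).2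
  set θ : Eucl n × Eucl n → ℝ := fun z => κ z.2 * Θ z
  have hθ : ContDiff ℝ ∞ θ := (hκ.comp contDiff_snd).mul hΘ
  have hθc : HasCompactSupport θ := hΘc.mul_left
  have hb := ha.isAmplitude hθ hθc
  obtain ⟨A, -, hA⟩ := hb.exists_L2_bound s
  have hC' : IsCompact (Prod.fst '' tsupport θ) := hθc.isCompact.image continuous_fst
  refine ⟨Prod.fst '' tsupport θ, hC', A, fun u hu huC => ?_⟩
  obtain ⟨U, hUn, hU⟩ := MemSobolev.exists_fourier_eq hu
  obtain ⟨V, hVn, hV⟩ := hA U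
  obtain ⟨v, hv, hvn, hvV⟩ := exists_memSobolev_of_fourier (s - m) V
  have hmain : ∀ φ : Test n, ∃ g₁ : Test n, v (toSchwartz φ) = u (toSchwartz g₁) ∧
      (∀ ψ : Test n, K (smoothMul hθ (tensor φ ψ)) = ∫ y, ψ y * g₁ y) ∧
      (Disjoint (tsupport φ) (Prod.fst '' tsupport θ) → g₁ = 0) := by
    intro φ
    obtain ⟨g₁, h1, h2, h3⟩ := hb.exists_transpose_of_fourier φ
    refine ⟨g₁, ?_, fun ψ => ?_, h3⟩
    · rw [hvV, hU, hV]
      exact h2 s U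
    · rw [kernel_smoothMul_tensor_eq ha hosc hθ hθc, h1]
  have himage : ∀ φ g : Test n, IsTransposeApply P φ g → v (toSchwartz φ) = u (toSchwartz g) := by
    intro φ g hg
    obtain ⟨g₁, h1, h2, -⟩ := hmain φ
    -- The localized operator is the original one applied to `κ ψ`, so its transpose is `κ P^t`.
    have hg₁ : g₁ = smoothMul hκ g := by
      refine test_eq_of_integral_eq fun ψ => ?_
      have h4 : smoothMul hθ (tensor φ ψ) = smoothMul hΘ (tensor φ (smoothMul hκ ψ)) := by
        refine TestFunction.ext fun z => ?_
        change (κ z.2 * Θ z) • (φ z.1 * ψ z.2) = Θ z • (φ z.1 * (κ z.2 • ψ z.2))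
        simp only [Complex.real_smul]
        push_cast
        ring
      rw [← h2, h4, smoothMul_tensor_eq (T := dsupport K ∩ Prod.snd ⁻¹' tsupport κ)
        (fun z hz _ h5 => ⟨hz, tsupport_smul_subset_left κ ψ h5⟩) hΘ hΘ1, ← hPK, hg]
      refine integral_congr_ae (Eventually.of_forall fun y => ?_)
      simp only [smoothMul_apply, Complex.real_smul]
      ring
    rw [h1, hg₁, ← sub_eq_zero, ← map_sub]
    -- `κ = 1` near the support of `u`, so `u` does not distinguish `κ g` from `g`.
    have h6 := tempered_eq_zero_of_disjoint u (smoothMul hκ g - g)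
      (Set.disjoint_left.2 fun z hz hzu => ?_)
    · exact h6
    · refine notMem_tsupport_iff_eventuallyEq.2 ?_ hz
      filter_upwards [(eventually_nhdsSet_iff_forall.1 hκ1) z (huC hzu)] with y hy
      rw [sub_apply, smoothMul_apply, hy, one_smul, sub_self, Pi.zero_apply]
  refine ⟨v, hv, dsupport_subset_of_test hC'.isClosed fun φ hφ => ?_, ?_, himage⟩
  · obtain ⟨g₁, h1, -, h3⟩ := hmain φ
    rw [h1, h3 hφ]
    exact map_zero u
  · rw [hvn, ← hUn]
    exact hVn

/-- The image of each `u` is built from a cutoff adapted to its own support. Its values on test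
functions depend only on `u` and the transpose, so density gives linearity and agreement with the
image built for any larger compact set, whose uniform bound carries over. -/
theorem exists_linearMap_Hc {P : Test n →ₗ[ℂ] Distr n} {K : Kernel2 n}
    (hPK : HasSchwartzKernel P K) (hK : IsPseudoDiffKernel m K) (hproper : IsProperlySupported K)
    (s : ℝ) : ∃ T : Hc n s →ₗ[ℂ] Hc n (s - m),
      (∀ u : Hc n s, IsImage P (u : 𝓢'(Eucl n, ℂ)) (T u : 𝓢'(Eucl n, ℂ))) ∧
      IsContinuousHc T := by
  choose t ht using exists_isTransposeApply hPK hK hproper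
  have hex : ∀ u : Hc n s, ∃ v : Hc n (s - m), ∀ φ : Test n,
      (v : 𝓢'(Eucl n, ℂ)) (toSchwartz φ) = (u : 𝓢'(Eucl n, ℂ)) (toSchwartz (t φ)) := by
    intro u
    obtain ⟨C', hC', A, h⟩ := exists_bounded_image hPK hK hproper s u.2.2
    obtain ⟨v, hv, hvC, -, hvim⟩ := h u u.2.1 subset_rfl
    exact ⟨⟨v, hv, hC'.of_isClosed_subset isClosed_dsupport hvC⟩, fun φ => hvim φ _ (ht φ)⟩
  choose T hT using hex
  have hlin : ∃ T : Hc n s →ₗ[ℂ] Hc n (s - m), ∀ (u : Hc n s) (φ : Test n),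
      (T u : 𝓢'(Eucl n, ℂ)) (toSchwartz φ) = (u : 𝓢'(Eucl n, ℂ)) (toSchwartz (t φ)) := by
    refine ⟨⟨⟨T, fun u v => ?_⟩, fun c u => ?_⟩, hT⟩
    · refine Subtype.ext (tempered_ext fun φ => ?_)
      rw [hT]
      change (u : 𝓢'(Eucl n, ℂ)) (toSchwartz (t φ)) + (v : 𝓢'(Eucl n, ℂ)) (toSchwartz (t φ))
        = (T u : 𝓢'(Eucl n, ℂ)) (toSchwartz φ) + (T v : 𝓢'(Eucl n, ℂ)) (toSchwartz φ)
      rw [hT, hT]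
    · refine Subtype.ext (tempered_ext fun φ => ?_)
      rw [hT]
      change c • (u : 𝓢'(Eucl n, ℂ)) (toSchwartz (t φ)) = c • (T u : 𝓢'(Eucl n, ℂ)) (toSchwartz φ)
      rw [hT]
  clear hT T
  obtain ⟨T, hT⟩ := hlin
  refine ⟨T, fun u φ => ⟨t φ, ht φ, hT u φ⟩, fun C hC => ?_⟩
  · obtain ⟨C', hC', A, h⟩ := exists_bounded_image hPK hK hproper s hC
    refine ⟨C', hC', A, fun u huC => ?_⟩
    obtain ⟨v, -, hvC, hvn, hvim⟩ := h u u.2.1 huC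
    have hTu : (T u : 𝓢'(Eucl n, ℂ)) = v :=
      tempered_ext fun φ => (hT u φ).trans (hvim φ _ (ht φ)).symm
    rw [hTu]
    exact ⟨hvC, hvn⟩

/-! ### Order zero: compactly supported square integrable functions -/

theorem sobolevNorm_zero_coe (f : L2 n) : sobolevNorm 0 (f : 𝓢'(Eucl n, ℂ)) = ‖f‖ :=
  sobolevNorm_eq (by rw [besselPotential_zero]; rfl)

/-- The Sobolev result at `s = m = 0`, where `H⁰ = L²` isometrically and vanishing a.e. off a closed
set matches containment of the distributional support. -/
theorem exists_bounded_image_L2 {P : Test n →ₗ[ℂ] Distr n} {K : Kernel2 n}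
    (hPK : HasSchwartzKernel P K) (hK : IsPseudoDiffKernel 0 K) (hproper : IsProperlySupported K)
    {C : Set (Eucl n)} (hC : IsCompact C) :
    ∃ C' : Set (Eucl n), IsCompact C' ∧ ∃ A : ℝ, ∀ f : L2 n, SupportedIn f C →
      ∃ f' : L2 n, SupportedIn f' C' ∧ ‖f'‖ ≤ A * ‖f‖ ∧ ∀ φ g : Test n, IsTransposeApply P φ g →
        (f' : 𝓢'(Eucl n, ℂ)) (toSchwartz φ) = (f : 𝓢'(Eucl n, ℂ)) (toSchwartz g) := by
  obtain ⟨C', hC', A, h⟩ := exists_bounded_image hPK hK hproper 0 hC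
  refine ⟨C', hC', A, fun f hf => ?_⟩
  obtain ⟨v, hv, hvC, hvn, hvim⟩ := h f (memSobolev_zero_iff.2 ⟨f, rfl⟩)
    (dsupport_subset_of_supportedIn hC.isClosed hf)
  rw [sub_zero] at hv hvn
  obtain ⟨f', rfl⟩ := memSobolev_zero_iff.1 hv
  rw [sobolevNorm_zero_coe, sobolevNorm_zero_coe] at hvn
  exact ⟨f', supportedIn_of_dsupport_subset hC'.isClosed hvC, hvn, hvim⟩

theorem L2_ext {f f' : L2 n} (h : ∀ φ : Test n,
    (f : 𝓢'(Eucl n, ℂ)) (toSchwartz φ) = (f' : 𝓢'(Eucl n, ℂ)) (toSchwartz φ)) : f = f' :=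
  LinearMap.ker_eq_bot.1 (Lp.ker_toTemperedDistributionCLM_eq_bot (F := ℂ)
    (μ := (volume : Measure (Eucl n))) (p := 2)) (tempered_ext h)

theorem exists_linearMap_L2c {P : Test n →ₗ[ℂ] Distr n} {K : Kernel2 n}
    (hPK : HasSchwartzKernel P K) (hK : IsPseudoDiffKernel 0 K) (hproper : IsProperlySupported K) :
    ∃ T : L2c n →ₗ[ℂ] L2c n,
      (∀ f : L2c n, IsImage P ((f : L2 n) : 𝓢'(Eucl n, ℂ)) ((T f : L2 n) : 𝓢'(Eucl n, ℂ))) ∧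
      IsContinuousL2c T := by
  choose t ht using exists_isTransposeApply hPK hK hproper
  have hex : ∀ f : L2c n, ∃ f' : L2c n, ∀ φ : Test n,
      ((f' : L2 n) : 𝓢'(Eucl n, ℂ)) (toSchwartz φ)
        = ((f : L2 n) : 𝓢'(Eucl n, ℂ)) (toSchwartz (t φ)) := by
    intro f
    obtain ⟨C, hC, hfC⟩ := f.2
    obtain ⟨C', hC', A, h⟩ := exists_bounded_image_L2 hPK hK hproper hC
    obtain ⟨f', hf'C, -, hf'im⟩ := h f hfC
    exact ⟨⟨f', C', hC', hf'C⟩, fun φ => hf'im φ _ (ht φ)⟩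
  choose T hT using hex
  have hadd : ∀ (f g : L2 n) (φ : 𝓢(Eucl n, ℂ)),
      ((f + g : L2 n) : 𝓢'(Eucl n, ℂ)) φ = (f : 𝓢'(Eucl n, ℂ)) φ + (g : 𝓢'(Eucl n, ℂ)) φ := by
    intro f g φ
    have h := map_add (Lp.toTemperedDistributionCLM ℂ (volume : Measure (Eucl n)) 2) f g
    exact congrArg (fun u : 𝓢'(Eucl n, ℂ) => u φ) h
  have hsmul : ∀ (c : ℂ) (f : L2 n) (φ : 𝓢(Eucl n, ℂ)),
      ((c • f : L2 n) : 𝓢'(Eucl n, ℂ)) φ = c • (f : 𝓢'(Eucl n, ℂ)) φ := by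
    intro c f φ
    have h := map_smul (Lp.toTemperedDistributionCLM ℂ (volume : Measure (Eucl n)) 2) c f
    exact congrArg (fun u : 𝓢'(Eucl n, ℂ) => u φ) h
  have hlin : ∃ T : L2c n →ₗ[ℂ] L2c n, ∀ (f : L2c n) (φ : Test n),
      ((T f : L2 n) : 𝓢'(Eucl n, ℂ)) (toSchwartz φ)
        = ((f : L2 n) : 𝓢'(Eucl n, ℂ)) (toSchwartz (t φ)) := by
    refine ⟨⟨⟨T, fun f g => ?_⟩, fun c f => ?_⟩, hT⟩
    · refine Subtype.ext (L2_ext fun φ => ?_)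
      rw [hT, Submodule.coe_add, Submodule.coe_add, hadd, hadd, hT, hT]
    · refine Subtype.ext (L2_ext fun φ => ?_)
      rw [hT, RingHom.id_apply, Submodule.coe_smul, Submodule.coe_smul, hsmul, hsmul, hT]
  clear hT T
  obtain ⟨T, hT⟩ := hlin
  refine ⟨T, fun f φ => ⟨t φ, ht φ, hT f φ⟩, fun C hC => ?_⟩
  · obtain ⟨C', hC', A, h⟩ := exists_bounded_image_L2 hPK hK hproper hC
    refine ⟨C', hC', A, fun f hfC => ?_⟩
    obtain ⟨f', hf'C, hf'n, hf'im⟩ := h f hfC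
    have hTf : (T f : L2 n) = f' := L2_ext fun φ => (hT f φ).trans (hf'im φ _ (ht φ)).symm
    rw [hTf]
    exact ⟨hf'C, hf'n⟩

end

end PseudoDiff

end

open PseudoDiff
theorem theorem6p3 (n : ℕ) (m : ℝ) (P : Test n →ₗ[ℂ] Distr n) (K : Kernel2 n)
    (hPK : HasSchwartzKernel P K) (hK : IsClassicalPseudoDiffKernel m K)
    (hproper : IsProperlySupported K) :
    (∀ s : ℝ, ∃ T : Hc n s →ₗ[ℂ] Hc n (s - m),
      (∀ u : Hc n s, IsImage P (u : 𝓢'(Eucl n, ℂ)) (T u : 𝓢'(Eucl n, ℂ))) ∧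
      IsContinuousHc T) ∧
    (m = 0 → ∃ T : L2c n →ₗ[ℂ] L2c n,
      (∀ f : L2c n, IsImage P ((f : L2 n) : 𝓢'(Eucl n, ℂ)) ((T f : L2 n) : 𝓢'(Eucl n, ℂ))) ∧
      IsContinuousL2c T) := by
  refine ⟨fun s => exists_linearMap_Hc hPK hK.1 hproper s, ?_⟩
  rintro rfl
  exact exists_linearMap_L2c hPK hK.1 hproper
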